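/- **Setting.** Let $L^2(\mathbb{R}^2)$ and $L^2(\mathbb{R}^2,\mathbb{C})$ denote the real-valued and the complex-valued square integrable functions on $\mathbb{R}^2$, let $\hat u$ be the Fourier transform of $u$ (normalized as $\hat u(x)=\int e^{-2\pi i\langle x,y\rangle}u(y)\,dy$, so that it is unitary on $L^2(\mathbb{R}^2,\mathbb{C})$ and $\widehat{k*u}=\hat k\,\hat u$), and put $\Delta(x)=1+|x|^2$, $\|u\|_{H^r}^2=\int_{\mathbb{R}^2}\Delta(x)^r|\hat u(x)|^2\,dx\in[0,\infty]$, $[w]_+=\max\{w,0\}$, and $\operatorname{sgn}(z)=z/|z|$ for $z\in\mathbb{C}\setminus\{0\}$, $\operatorname{sgn}(0)=0$. Norms $\|\cdot\|_{L^2}$ take the value $\infty$ on functions that are not square integrable, and pointwise relations between $L^2$ functions are understood for almost every $x\in\mathbb{R}^2$. **Lemma.** Let $f\in L^2(\mathbb{R}^2)$ be real-valued and band-limited (that is, $\hat f$ has compact support), let $r,s\ge 0$, and let $(\lambda_n)_{n\ge0}$, $(\mu_n)_{n\ge 0}$ be decreasing (not necessarily strictly) sequences of positive real numbers. (A) There are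 sequences $(U_n)_{n\ge 0}$, $(K_n)_{n\ge 0}$ of real-valued functions in $L^2(\mathbb{R}^2)$ with $$(U_0,K_0)\in\operatorname*{argmin}_{u,k\in L^2(\mathbb{R}^2)}\Big\{\|f-k*u\|_{L^2}^2+\lambda_0\|u\|_{H^r}^2+\mu_0\|k\|_{H^s}^2\Big\}$$ and, for all $n\ge 0$, $$(U_{n+1}-U_n,K_{n+1}-K_n)\in\operatorname*{argmin}_{u,k\in L^2(\mathbb{R}^2)}\Big\{\|f-(k+K_n)*(u+U_n)\|_{L^2}^2+\lambda_{n+1}\|u\|_{H^r}^2+\mu_{n+1}\|k\|_{H^s}^2\Big\},$$ such that $\hat K_n$ is real-valued and nonnegative for every $n\ge0$, and such that $P_n=\hat U_n$, $Q_n=\hat K_n$ satisfy the following rules. 1. $P_0=\operatorname{sgn}(\hat f)\sqrt{\Big[\sqrt{\tfrac{\mu_0}{\lambda_0}\Delta^{s-r}}\,|\hat f|-\mu_0\Delta^s\Big]_+}$ and $Q_0=\sqrt{\Big[\sqrt{\tfrac{\lambda_0}{\mu_0}\Delta^{r-s}}\,|\hat f|-\lambda_0\Delta^r\Big]_+}$.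 2. For every $n\ge 0$ the increments $\hat u_{n+1}=P_{n+1}-P_n$ and $\hat k_{n+1}=Q_{n+1}-Q_n$ satisfy $$(\hat u_{n+1},\hat k_{n+1})\in\operatorname*{argmin}_{p,q\in L^2(\mathbb{R}^2,\mathbb{C})}\Big\{\|\hat f-(p+P_n)(q+Q_n)\|_{L^2}^2+\lambda_{n+1}\int\Delta^r|p|^2+\mu_{n+1}\int\Delta^s|q|^2\Big\},$$ as well as $\hat k_{n+1}(x)\in[0,\infty)$, $\hat k_{n+1}(x)=\hat k_{n+1}(-x)$, $\hat u_{n+1}(x)=\overline{\hat u_{n+1}(-x)}$, and $$\operatorname{sgn}(\hat u_{n+1}(x))=\begin{cases}\operatorname{sgn}(\hat f(x)),&\text{if }|\hat f(x)|^2>\lambda_{n+1}\mu_{n+1}\Delta(x)^{r+s},\\0,&\text{otherwise.}\end{cases}$$ Moreover, $(\hat u_{n+1},\hat k_{n+1})$ can be taken to be a pointwise solution: for every $n\ge0$ and almost every $x$, the pair $(\hat u_{n+1}(x),\hat k_{n+1}(x))$ minimizes $$|\hat f(x)-(p+\hat U_n(x))(q+\hat K_n(x))|^2+\lambda_{n+1}\Delta(x)^r|p|^2+\mu_{n+1}\Delta(x)^s|q|^2$$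 over $p,q\in\mathbb{C}$ (so that, by the symmetries in rule 2, it suffices to solve this problem for $x$ in a half-plane). (B) Conversely, whenever sequences $(P_n)$, $(Q_n)$ in $L^2(\mathbb{R}^2,\mathbb{C})$ satisfy rules 1 and 2, the inverse Fourier transforms $U_n$ of $P_n$ and $K_n$ of $Q_n$ are real-valued, satisfy the two argmin conditions in (A), and have $\hat K_n=Q_n$ real-valued and nonnegative for all $n\ge0$. -/

import Mathlib

open MeasureTheory Set
open scoped FourierTransform ENNReal Convolution ComplexConjugate

noncomputable section

namespace BlindMHDM

/-- The plane `ℝ²` with its Euclidean norm. -/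
abbrev Plane : Type := EuclideanSpace ℝ (Fin 2)

/-- Real-valued square integrable functions on the plane. -/
abbrev L2R : Type := Lp (α := Plane) ℝ 2 volume

/-- Complex-valued square integrable functions on the plane. -/
abbrev L2C : Type := Lp (α := Plane) ℂ 2 volume

/-- The (unitary) Fourier transform of a real-valued `L²` function. The normalization is
`∫ e^{-2πi⟨x,ξ⟩} u(x) dx`, for which the Fourier transform of a convolution is the product of the
Fourier transforms without any constant. -/
def hat (u : L2R) : L2C := 𝓕 (Complex.ofRealCLM.compLp u : L2C)

/-- `Δ(x) = 1 + |x|²`. -/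
def Δ (x : Plane) : ℝ := 1 + ‖x‖ ^ 2

/-- `z / |z|` for `z ≠ 0`, and `0` for `z = 0`. -/
def sgn (z : ℂ) : ℂ := z / (‖z‖ : ℂ)

/-- `∫ Δ(x)^r |g(x)|² dx`, with value `∞` if the integral diverges. -/
def weightedSq (r : ℝ) (g : Plane → ℂ) : ℝ≥0∞ :=
  ∫⁻ x, ENNReal.ofReal (Δ x ^ r) * ‖g x‖ₑ ^ 2

/-- The squared Bessel potential norm `‖u‖²_{H^r}`, with value `∞` if `u ∉ H^r`. -/
def sobolevSq (r : ℝ) (u : L2R) : ℝ≥0∞ := weightedSq r (hat u)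

/-- The convolution `k * u` of two `L²` functions (a bounded continuous function, which need not
be square integrable). -/
def conv (k u : L2R) : Plane → ℝ :=
  (k : Plane → ℝ) ⋆[ContinuousLinearMap.mul ℝ ℝ, volume] (u : Plane → ℝ)

/-- `‖f - (k + K) * (u + U)‖²_{L²} + l ‖u‖²_{H^r} + m ‖k‖²_{H^s}`, with values in `[0, ∞]`. -/
def objective (f : L2R) (r s l m : ℝ) (U K u k : L2R) : ℝ≥0∞ :=
  eLpNorm (fun x => f x - conv (k + K) (u + U) x) 2 volume ^ 2
    + ENNReal.ofReal l * sobolevSq r u + ENNReal.ofReal m * sobolevSq s k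

/-- `(u, k)` minimizes the objective over all pairs of real-valued `L²` functions. -/
def IsStepMin (f : L2R) (r s l m : ℝ) (U K u k : L2R) : Prop :=
  ∀ v h : L2R, objective f r s l m U K u k ≤ objective f r s l m U K v h

/-- `(U, K)` is a sequence of iterates of the multiscale hierarchical decomposition method for
blind deconvolution of `f`, without constraint sets. -/
structure IsMHDM (f : L2R) (r s : ℝ) (lam mu : ℕ → ℝ) (U K : ℕ → L2R) : Prop where
  init : IsStepMin f r s (lam 0) (mu 0) 0 0 (U 0) (K 0)
  step : ∀ n, IsStepMin f r s (lam (n + 1)) (mu (n + 1)) (U n) (K n)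
    (U (n + 1) - U n) (K (n + 1) - K n)

/-- The Fourier transform of `f` vanishes outside a compact set. -/
def IsBandLimited (f : L2R) : Prop :=
  ∃ C : Set Plane, IsCompact C ∧ ∀ᵐ x, x ∉ C → hat f x = 0

/-- `g` is real-valued and nonnegative (almost everywhere). -/
def IsNonneg (g : L2C) : Prop := ∀ᵐ x, (g x).im = 0 ∧ 0 ≤ (g x).re

/-- The Fourier-side objective
`‖F - (p + P)(q + Q)‖²_{L²} + l ∫ Δ^r |p|² + m ∫ Δ^s |q|²`, with values in `[0, ∞]`. -/
def fourierObjective (F : L2C) (r s l m : ℝ) (P Q p q : L2C) : ℝ≥0∞ :=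
  eLpNorm (fun x => F x - (p x + P x) * (q x + Q x)) 2 volume ^ 2
    + ENNReal.ofReal l * weightedSq r p + ENNReal.ofReal m * weightedSq s q

/-- `(p, q)` minimizes the Fourier-side objective over all pairs of complex `L²` functions. -/
def IsFourierStepMin (F : L2C) (r s l m : ℝ) (P Q p q : L2C) : Prop :=
  ∀ v h : L2C, fourierObjective F r s l m P Q p q ≤ fourierObjective F r s l m P Q v h

/-- `|z - (p + p₀)(q + q₀)|² + a |p|² + b |q|²`. -/
def pointObjective (z p₀ q₀ : ℂ) (a b : ℝ) (p q : ℂ) : ℝ :=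
  ‖z - (p + p₀) * (q + q₀)‖ ^ 2 + a * ‖p‖ ^ 2 + b * ‖q‖ ^ 2

/-- The Fourier-side increments `(p n, q n) = (P (n+1) - P n, Q (n+1) - Q n)` solve at almost every
frequency the pointwise minimization problem over `ℂ × ℂ`. -/
def IsPointwiseMin (F : L2C) (r s : ℝ) (lam mu : ℕ → ℝ) (P Q : ℕ → L2C) : Prop :=
  ∀ n, ∀ᵐ x, ∀ v h : ℂ,
    pointObjective (F x) (P n x) (Q n x) (lam (n + 1) * Δ x ^ r) (mu (n + 1) * Δ x ^ s)
        ((P (n + 1) - P n) x) ((Q (n + 1) - Q n) x)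
      ≤ pointObjective (F x) (P n x) (Q n x) (lam (n + 1) * Δ x ^ r) (mu (n + 1) * Δ x ^ s) v h

/-- The recipe in Fourier space, for the datum `F = f̂` and the iterates `(P n, Q n) = (Û_n, K̂_n)`:
the formulas for the first iterates, and the requirements on the increments
`û_{n+1} = P (n + 1) - P n` and `k̂_{n+1} = Q (n + 1) - Q n`. -/
structure IsFourierRecipe (F : L2C) (r s : ℝ) (lam mu : ℕ → ℝ) (P Q : ℕ → L2C) : Prop where
  init_image : ∀ᵐ x, P 0 x = sgn (F x) *
    (√(max (√(mu 0 / lam 0 * Δ x ^ (s - r)) * ‖F x‖ - mu 0 * Δ x ^ s) 0) : ℝ)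
  init_kernel : ∀ᵐ x, Q 0 x =
    (√(max (√(lam 0 / mu 0 * Δ x ^ (r - s)) * ‖F x‖ - lam 0 * Δ x ^ r) 0) : ℝ)
  step_min : ∀ n, IsFourierStepMin F r s (lam (n + 1)) (mu (n + 1)) (P n) (Q n)
    (P (n + 1) - P n) (Q (n + 1) - Q n)
  kernel_nonneg : ∀ n, IsNonneg (Q (n + 1) - Q n)
  kernel_symm : ∀ n, ∀ᵐ x, (Q (n + 1) - Q n) x = (Q (n + 1) - Q n) (-x)
  image_symm : ∀ n, ∀ᵐ x, (P (n + 1) - P n) x = conj ((P (n + 1) - P n) (-x))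
  /-- The image increment has the phase of `F` at the frequencies that are not thresholded at
  this step, and vanishes at the others. -/
  image_sgn : ∀ n, ∀ᵐ x,
    (lam (n + 1) * mu (n + 1) * Δ x ^ (r + s) < ‖F x‖ ^ 2 →
      sgn ((P (n + 1) - P n) x) = sgn (F x)) ∧
    (‖F x‖ ^ 2 ≤ lam (n + 1) * mu (n + 1) * Δ x ^ (r + s) → (P (n + 1) - P n) x = 0)

end BlindMHDM

end

/-! By Plancherel and the convolution theorem, each objective is an integral over frequencies of
`pointObjective`, so a pair that minimizes pointwise almost everywhere minimizes globally.

Statement (B): the symmetries of a recipe make `P n` and `Q n` Hermitian, hence Fourier transforms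
of real functions (`exists_hat_eq`). A minimizer among all complex pairs is then also one among
transforms of real pairs. The first iterates minimize by the explicit soft-thresholding computation
`realObjective_initAmplitude_le`.

Statement (A) needs a recipe. Dividing out the phase of the datum leaves a problem with datum `z ≥
0` and nonnegative unknowns. Eliminating the kernel increment by completing a square leaves a
coercive function of one variable, whose least minimizer is taken. The invariant `IsAdmissible`
survives each step: with `D` the new residual and `P`, `Q` the new iterates, the equations `a p = D
Q` and `b q = D P` force `D > 0` and `p > 0` above the threshold (`step_of_lt`), and `p = q = 0`
below it (`step_of_ge`). The selection is measurable and depends only on `‖F x‖` and `Δ x`, so it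
inherits evenness; each increment is bounded by a constant times `‖F x‖`, so it lies in `L²`. -/

namespace BlindMHDM

open SchwartzMap

/-! ### Distributional Fourier pairs and Plancherel with infinite values -/

/-- `h` is the Fourier transform of `g` in the sense of tempered distributions. -/
def IsFourierPair (g h : Plane → ℂ) : Prop :=
  ∀ φ : 𝓢(Plane, ℂ), ∫ x, φ x * h x = ∫ x, 𝓕 φ x * g x

lemma isFourierPair_fourier (g : L2C) : IsFourierPair g (𝓕 g : L2C) := by
  intro φ
  have h := congrArg (fun T : 𝓢'(Plane, ℂ) => T φ) (Lp.fourier_toTemperedDistribution_eq g)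
  simpa [Lp.toTemperedDistribution_apply] using h.symm

/-- Compactly supported smooth functions are Schwartz functions, so the fundamental lemma of the
calculus of variations applies. -/
lemma ae_eq_of_integral_schwartz_mul_eq {g h : Plane → ℂ} (hg : LocallyIntegrable g)
    (hh : LocallyIntegrable h) (H : ∀ φ : 𝓢(Plane, ℂ), ∫ x, φ x * g x = ∫ x, φ x * h x) :
    g =ᵐ[volume] h := by
  refine ae_eq_of_integral_contDiff_smul_eq hg hh fun η η_smooth η_cpt => ?_
  have h₁ : HasCompactSupport (Complex.ofRealCLM ∘ η) := η_cpt.comp_left rfl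
  have h₂ : ContDiff ℝ (⊤ : ℕ∞) (Complex.ofRealCLM ∘ η) := by fun_prop
  simpa using H (h₁.toSchwartzMap h₂)

lemma locallyIntegrable_coe (g : L2C) : LocallyIntegrable g :=
  (Lp.memLp g).locallyIntegrable (by norm_num)

lemma IsFourierPair.fourier_ae_eq {g : L2C} {h : Plane → ℂ} (hh : LocallyIntegrable h)
    (H : IsFourierPair g h) : (𝓕 g : L2C) =ᵐ[volume] h :=
  ae_eq_of_integral_schwartz_mul_eq (locallyIntegrable_coe _) hh fun φ => by
    rw [H φ, isFourierPair_fourier g φ]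

lemma IsFourierPair.fourierInv_ae_eq {g : Plane → ℂ} {h : L2C} (hg : LocallyIntegrable g)
    (H : IsFourierPair g h) : (𝓕⁻ h : L2C) =ᵐ[volume] g :=
  ae_eq_of_integral_schwartz_mul_eq (locallyIntegrable_coe _) hg fun φ => by
    have h₁ := isFourierPair_fourier (𝓕⁻ h : L2C) (𝓕⁻ φ)
    have h₂ := H (𝓕⁻ φ)
    simp only [FourierTransform.fourier_fourierInv_eq] at h₁ h₂
    rw [← h₁, h₂]

lemma IsFourierPair.congr {g g' h h' : Plane → ℂ} (H : IsFourierPair g h)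
    (hg : g =ᵐ[volume] g') (hh : h =ᵐ[volume] h') : IsFourierPair g' h' := by
  intro φ
  calc ∫ x, φ x * h' x = ∫ x, φ x * h x :=
        integral_congr_ae (by filter_upwards [hh] with x hx; rw [hx])
    _ = ∫ x, 𝓕 φ x * g x := H φ
    _ = ∫ x, 𝓕 φ x * g' x := integral_congr_ae (by filter_upwards [hg] with x hx; rw [hx])

lemma enorm_fourier_eq (g : L2C) : eLpNorm (𝓕 g : L2C) 2 volume = eLpNorm g 2 volume := by
  rw [← Lp.enorm_def, ← Lp.enorm_def, ← ofReal_norm, ← ofReal_norm, Lp.norm_fourier_eq]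

/-- Plancherel's identity for distributional Fourier pairs, with values in `[0, ∞]`. -/
lemma IsFourierPair.eLpNorm_eq {g h : Plane → ℂ} (H : IsFourierPair g h)
    (hg : LocallyIntegrable g) (hh : LocallyIntegrable h) :
    eLpNorm h 2 volume = eLpNorm g 2 volume := by
  by_cases hg2 : MemLp g 2 volume
  · have H' : IsFourierPair (hg2.toLp g) h := H.congr hg2.coeFn_toLp.symm (ae_eq_refl _)
    rw [← eLpNorm_congr_ae (H'.fourier_ae_eq hh), enorm_fourier_eq,
      eLpNorm_congr_ae hg2.coeFn_toLp]
  by_cases hh2 : MemLp h 2 volume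
  · have H' : IsFourierPair g (hh2.toLp h) := H.congr (ae_eq_refl _) hh2.coeFn_toLp.symm
    have h₁ := enorm_fourier_eq (𝓕⁻ (hh2.toLp h) : L2C)
    rw [FourierTransform.fourier_fourierInv_eq] at h₁
    rw [← eLpNorm_congr_ae hh2.coeFn_toLp, h₁, eLpNorm_congr_ae (H'.fourierInv_ae_eq hg)]
  -- If neither function is square integrable, both norms are infinite. This case matters because a
  -- residual need not lie in `L²`.
  · have e₁ : eLpNorm g 2 volume = ⊤ := by
      by_contra hne
      exact hg2 ⟨hg.aestronglyMeasurable, lt_top_iff_ne_top.2 hne⟩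
    have e₂ : eLpNorm h 2 volume = ⊤ := by
      by_contra hne
      exact hh2 ⟨hh.aestronglyMeasurable, lt_top_iff_ne_top.2 hne⟩
    rw [e₁, e₂]

lemma integrable_schwartz_mul_of_memLp (φ : 𝓢(Plane, ℂ)) {g : Plane → ℂ}
    (hg : MemLp g 2 volume) : Integrable fun x => φ x * g x :=
  (φ.memLp 2 volume).integrable_mul hg

lemma integrable_schwartz_mul_of_bounded (φ : 𝓢(Plane, ℂ)) {g : Plane → ℂ}
    (hg : AEStronglyMeasurable g volume) {C : ℝ} (hC : ∀ x, ‖g x‖ ≤ C) :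
    Integrable fun x => φ x * g x :=
  φ.integrable.mul_bdd hg (Filter.Eventually.of_forall hC)

lemma integrable_schwartz_mul_of_integrable (φ : 𝓢(Plane, ℂ)) {g : Plane → ℂ}
    (hg : Integrable g) : Integrable fun x => φ x * g x :=
  hg.bdd_mul φ.continuous.aestronglyMeasurable
    (Filter.Eventually.of_forall φ.toBoundedContinuousFunction.norm_coe_le_norm)

lemma continuous_fourierInv {w : Plane → ℂ} (hw : Integrable w) : Continuous (𝓕⁻ w) :=
  VectorFourier.fourierIntegral_continuous Real.continuous_fourierChar
    (by simpa using! continuous_inner.neg) hw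

/-- Fubini moves the inverse transform from `w` onto `𝓕 φ`, where Schwartz inversion returns `φ`. -/
lemma isFourierPair_fourierInv {w : Plane → ℂ} (hw : Integrable w) : IsFourierPair (𝓕⁻ w) w := by
  intro φ
  have h := VectorFourier.integral_fourierIntegral_smul_eq_flip (μ := volume) (ν := volume)
    (L := -innerₗ Plane) (f := w) (g := (𝓕 φ : 𝓢(Plane, ℂ))) Real.continuous_fourierChar
    (by simpa using! continuous_inner.neg) hw (𝓕 φ).integrable
  have e : VectorFourier.fourierIntegral Real.fourierChar volume (-innerₗ Plane).flip
      (𝓕 φ : 𝓢(Plane, ℂ))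
      = φ := by
    rw [show (-innerₗ Plane).flip = -innerₗ Plane by ext x y; simp [real_inner_comm]]
    change 𝓕⁻ ((𝓕 φ : 𝓢(Plane, ℂ)) : Plane → ℂ) = φ
    rw [← fourierInv_coe, FourierTransform.fourierInv_fourier_eq]
  rw [e] at h
  simp only [smul_eq_mul] at h
  simp only [mul_comm (φ _), mul_comm (𝓕 φ _)]
  exact h.symm

lemma norm_fourierInv_le {w : Plane → ℂ} (x : Plane) : ‖𝓕⁻ w x‖ ≤ ∫ y, ‖w y‖ :=
  VectorFourier.norm_fourierIntegral_le_integral_norm _ _ _ _ _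

/-- Models the residual: a product of two `L²` transforms is only known to be integrable, and its
inverse transform only bounded and continuous. Against a Schwartz function every term is
nevertheless integrable. -/
lemma IsFourierPair.sub_fourierInv (f : L2C) {w : Plane → ℂ} (hw : Integrable w) :
    IsFourierPair (fun x => f x - 𝓕⁻ w x) (fun x => (𝓕 f : L2C) x - w x) := by
  intro φ
  simp only [mul_sub]
  rw [integral_sub (integrable_schwartz_mul_of_memLp φ (Lp.memLp _))
    (integrable_schwartz_mul_of_integrable φ hw),
    integral_sub (integrable_schwartz_mul_of_memLp (𝓕 φ) (Lp.memLp _))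
    (integrable_schwartz_mul_of_bounded (𝓕 φ)
      (continuous_fourierInv hw).aestronglyMeasurable norm_fourierInv_le),
    isFourierPair_fourier f φ, isFourierPair_fourierInv hw φ]

lemma eLpNorm_sub_fourierInv (f : L2C) {w : Plane → ℂ} (hw : Integrable w) :
    eLpNorm (fun x => (𝓕 f : L2C) x - w x) 2 volume
      = eLpNorm (fun x => f x - 𝓕⁻ w x) 2 volume :=
  (IsFourierPair.sub_fourierInv f hw).eLpNorm_eq
    ((locallyIntegrable_coe f).sub (continuous_fourierInv hw).locallyIntegrable)
    ((locallyIntegrable_coe _).sub hw.locallyIntegrable)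

/-! ### Hermitian symmetry and real-valued functions -/

/-- The Schwartz function `x ↦ conj (φ (-x))`. -/
noncomputable def conjNeg (φ : 𝓢(Plane, ℂ)) : 𝓢(Plane, ℂ) :=
  compCLMOfContinuousLinearEquiv ℝ (ContinuousLinearEquiv.neg ℝ)
    (φ.postcompCLM (Complex.conjCLE : ℂ →L[ℝ] ℂ))

lemma conjNeg_apply (φ : 𝓢(Plane, ℂ)) (x : Plane) : conjNeg φ x = conj (φ (-x)) := rfl

lemma fourier_conjNeg (φ : 𝓢(Plane, ℂ)) (x : Plane) : 𝓕 (conjNeg φ) x = conj (𝓕 φ x) := by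
  rw [fourier_coe, fourier_coe, Real.fourier_eq, Real.fourier_eq, ← integral_conj,
    ← integral_neg_eq_self]
  refine integral_congr_ae (Filter.Eventually.of_forall fun v => ?_)
  simp [conjNeg_apply, Circle.smul_def, AddChar.map_neg_eq_inv]

lemma isFourierPair_conj (g : L2C) :
    IsFourierPair (fun x => conj (g x)) (fun x => conj ((𝓕 g : L2C) (-x))) := by
  intro φ
  have h := congrArg (starRingEnd ℂ) (isFourierPair_fourier g (conjNeg φ))
  rw [← integral_conj, ← integral_conj, ← integral_neg_eq_self] at h
  simpa [conjNeg_apply, fourier_conjNeg] using h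

lemma memLp_comp_neg {h : Plane → ℂ} (hh : MemLp h 2 volume) :
    MemLp (fun x => h (-x)) 2 volume :=
  hh.comp_measurePreserving (Measure.measurePreserving_neg volume)

lemma memLp_comp_sub {h : Plane → ℂ} (hh : MemLp h 2 volume) (a : Plane) :
    MemLp (fun x => h (a - x)) 2 volume :=
  hh.comp_measurePreserving (Measure.measurePreserving_sub_left volume a)

lemma memLp_conj {h : Plane → ℂ} (hh : MemLp h 2 volume) :
    MemLp (fun x => conj (h x)) 2 volume :=
  hh.star

lemma fourier_conj_ae_eq {g g' : L2C} (hg : g' =ᵐ[volume] fun x => conj (g x)) :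
    (𝓕 g' : L2C) =ᵐ[volume] fun x => conj ((𝓕 g : L2C) (-x)) :=
  ((isFourierPair_conj g).congr hg.symm (ae_eq_refl _)).fourier_ae_eq
    ((memLp_conj (memLp_comp_neg (Lp.memLp (𝓕 g : L2C)))).locallyIntegrable (by norm_num))

/-- The complexification of a real-valued square integrable function. -/
noncomputable def toL2C (u : L2R) : L2C := Complex.ofRealCLM.compLp u

lemma toL2C_ae_eq (u : L2R) : toL2C u =ᵐ[volume] fun x => (u x : ℂ) :=
  Complex.ofRealCLM.coeFn_compLp u

lemma hat_eq_fourier (u : L2R) : hat u = 𝓕 (toL2C u) := rfl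

/-- The Hermitian symmetry of Fourier transforms of real-valued functions. -/
def IsHermitian (g : L2C) : Prop := ∀ᵐ x, g x = conj (g (-x))

lemma isHermitian_hat (u : L2R) : IsHermitian (hat u) := by
  refine fourier_conj_ae_eq (g := toL2C u) ?_
  filter_upwards [toL2C_ae_eq u] with x hx
  change toL2C u x = _
  rw [hx, Complex.conj_ofReal]

/-- The inverse transform `g` of `P` and its conjugate have the same Fourier transform, so `g`
equals its conjugate and is the complexification of its real part. -/
lemma exists_hat_eq {P : L2C} (hP : IsHermitian P) : ∃ U : L2R, hat U = P := by
  set g : L2C := 𝓕⁻ P with hg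
  have hFg : 𝓕 g = P := FourierTransform.fourier_fourierInv_eq P
  have hc := memLp_conj (Lp.memLp g)
  have e : hc.toLp _ = g := by
    have h₁ : (𝓕 (hc.toLp _) : L2C) = 𝓕 g := by
      rw [hFg]
      refine Lp.ext ((fourier_conj_ae_eq (g := g) hc.coeFn_toLp).trans ?_)
      rw [hFg]
      filter_upwards [hP] with x hx using hx.symm
    have h₂ := congrArg (fun v : L2C => (𝓕⁻ v : L2C)) h₁
    simpa only [FourierTransform.fourierInv_fourier_eq] using h₂
  refine ⟨Complex.reCLM.compLp g, ?_⟩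
  have h₃ : toL2C (Complex.reCLM.compLp g) = g := by
    refine Lp.ext ?_
    have h₄ := hc.coeFn_toLp
    rw [e] at h₄
    filter_upwards [toL2C_ae_eq (Complex.reCLM.compLp g), Complex.reCLM.coeFn_compLp g, h₄]
      with x h₅ h₆ h₇
    rw [h₅, h₆]
    exact Complex.conj_eq_iff_re.1 h₇.symm
  rw [hat_eq_fourier, h₃, hFg]

lemma hat_sub (u v : L2R) : hat (u - v) = hat u - hat v := by
  have h : toL2C (u - v) = toL2C u - toL2C v :=
    map_sub (Complex.ofRealCLM.compLpL 2 (volume : Measure Plane)) u v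
  rw [hat_eq_fourier, h]
  exact map_sub (Lp.fourierTransformₗᵢ Plane ℂ) _ _

lemma hat_add (u v : L2R) : hat (u + v) = hat u + hat v := by
  have h : toL2C (u + v) = toL2C u + toL2C v :=
    map_add (Complex.ofRealCLM.compLpL 2 (volume : Measure Plane)) u v
  rw [hat_eq_fourier, h]
  exact map_add (Lp.fourierTransformₗᵢ Plane ℂ) _ _

lemma hat_zero : hat 0 = 0 := by
  have h := hat_sub 0 0
  simpa using h

/-! ### The convolution theorem and the passage to Fourier space -/

/-- The Schwartz function `x ↦ φ (a - x)`. -/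
noncomputable def reflectAt (a : Plane) (φ : 𝓢(Plane, ℂ)) : 𝓢(Plane, ℂ) :=
  (compCLMOfContinuousLinearEquiv ℂ (ContinuousLinearEquiv.neg ℝ) φ).compSubConstCLM ℂ a

lemma reflectAt_apply (a : Plane) (φ : 𝓢(Plane, ℂ)) (x : Plane) :
    reflectAt a φ x = φ (a - x) := by
  change φ (-(x - a)) = _
  rw [neg_sub]

lemma fourierInv_reflectAt (a : Plane) (φ : 𝓢(Plane, ℂ)) (ξ : Plane) :
    𝓕⁻ (reflectAt a φ) ξ = Real.fourierChar (inner ℝ a ξ) • 𝓕⁻ φ (-ξ) := by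
  rw [fourierInv_coe, fourierInv_coe, Real.fourierInv_eq, Real.fourierInv_eq,
    ← integral_sub_left_eq_self _ volume a, Circle.smul_def, ← integral_smul]
  refine integral_congr_ae (Filter.Eventually.of_forall fun v => ?_)
  have h : inner ℝ (a - v) ξ = inner ℝ a ξ + -inner ℝ v ξ := by
    rw [inner_sub_left, sub_eq_add_neg]
  simp only [reflectAt_apply, sub_sub_cancel, h, AddChar.map_add_eq_mul, Circle.smul_def,
    Circle.coe_mul, inner_neg_right, smul_eq_mul, mul_assoc]

lemma isFourierPair_reflectAt (a : Plane) (g : L2C) :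
    IsFourierPair (fun y => g (a - y))
      (fun ξ => Real.fourierChar (-inner ℝ a ξ) • (𝓕 g : L2C) (-ξ)) := by
  intro φ
  -- The transform of this test function is `𝓕 φ` reflected at `a`; a change of variables moves the
  -- reflection onto `g`.
  have h := isFourierPair_fourier g (𝓕⁻ (reflectAt a (𝓕 φ)))
  rw [FourierTransform.fourier_fourierInv_eq, ← integral_neg_eq_self,
    ← integral_sub_left_eq_self (fun x => reflectAt a (𝓕 φ) x * g x) volume a] at h
  simp only [reflectAt_apply, fourierInv_reflectAt, FourierTransform.fourierInv_fourier_eq,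
    neg_neg, inner_neg_right, sub_sub_cancel, smul_mul_assoc] at h
  simpa only [mul_smul_comm] using h

lemma fourier_reflectAt_ae_eq (a : Plane) {g g' : L2C} (hg : g' =ᵐ[volume] fun y => g (a - y)) :
    (𝓕 g' : L2C) =ᵐ[volume] fun ξ => Real.fourierChar (-inner ℝ a ξ) • (𝓕 g : L2C) (-ξ) := by
  refine ((isFourierPair_reflectAt a g).congr hg.symm (ae_eq_refl _)).fourier_ae_eq ?_
  refine MemLp.locallyIntegrable (p := 2) ?_ (by norm_num)
  refine (memLp_comp_neg (Lp.memLp (𝓕 g : L2C))).of_le ?_ (Filter.Eventually.of_forall fun x => ?_)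
  · simp only [Circle.smul_def]
    exact ((continuous_subtype_val.comp (Real.continuous_fourierChar.comp
      (by fun_prop))).aestronglyMeasurable).smul
      (memLp_comp_neg (Lp.memLp (𝓕 g : L2C))).aestronglyMeasurable
  · exact (Circle.norm_smul _ _).le

lemma integrable_hat_mul_hat (k u : L2R) : Integrable fun ξ => hat k ξ * hat u ξ :=
  (Lp.memLp (hat k)).integrable_mul (Lp.memLp (hat u))

/-- The convolution theorem for square integrable functions. -/
lemma conv_eq_fourierInv (k u : L2R) (x : Plane) :
    (conv k u x : ℂ) = 𝓕⁻ (fun ξ => hat k ξ * hat u ξ) x := by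
  have hm := memLp_comp_sub (Lp.memLp (toL2C u)) x
  set v : L2C := hm.toLp _ with hv
  -- The value of the convolution at `x` is the inner product of `v y = u (x - y)` with `k`.
  -- Parseval rewrites it, and the Hermitian symmetry of `hat u` absorbs the reflection and the
  -- conjugation.
  have h₁ : inner ℂ (𝓕 v : L2C) (hat k) = inner ℂ v (toL2C k) := Lp.inner_fourier_eq v (toL2C k)
  rw [L2.inner_def, L2.inner_def] at h₁
  have h₂ : ∫ y, inner ℂ (v y) (toL2C k y) = (conv k u x : ℂ) := by
    rw [conv, convolution_def, ← integral_complex_ofReal]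
    refine integral_congr_ae ?_
    have hu : ∀ᵐ y, toL2C u (x - y) = (u (x - y) : ℂ) :=
      (Measure.measurePreserving_sub_left volume x).quasiMeasurePreserving.ae (toL2C_ae_eq u)
    filter_upwards [hm.coeFn_toLp, toL2C_ae_eq k, hu] with y h₃ h₄ h₅
    rw [hv, h₃, h₄, h₅]
    simp
  rw [← h₂, ← h₁, Real.fourierInv_eq]
  refine integral_congr_ae ?_
  filter_upwards [fourier_reflectAt_ae_eq x hm.coeFn_toLp, isHermitian_hat u] with ξ h₃ h₄
  rw [h₃, ← hat_eq_fourier, h₄]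
  simp [Circle.smul_def, AddChar.map_neg_eq_inv, real_inner_comm]
  ring

lemma eLpNorm_sub_conv (f k u : L2R) :
    eLpNorm (fun x => f x - conv k u x) 2 volume
      = eLpNorm (fun x => hat f x - hat u x * hat k x) 2 volume := by
  have h := eLpNorm_sub_fourierInv (toL2C f) (integrable_hat_mul_hat k u)
  rw [← hat_eq_fourier] at h
  simp only [mul_comm (hat u _)]
  rw [h]
  refine eLpNorm_congr_norm_ae ?_
  filter_upwards [toL2C_ae_eq f] with x hx
  rw [hx, ← conv_eq_fourierInv, ← Complex.ofReal_sub, Complex.norm_real]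

lemma objective_eq (f : L2R) (r s l m : ℝ) (U K u k : L2R) :
    objective f r s l m U K u k
      = fourierObjective (hat f) r s l m (hat U) (hat K) (hat u) (hat k) := by
  rw [objective, fourierObjective, eLpNorm_sub_conv, hat_add, hat_add, sobolevSq, sobolevSq]
  congr 3
  refine eLpNorm_congr_ae ?_
  filter_upwards [Lp.coeFn_add (hat u) (hat U), Lp.coeFn_add (hat k) (hat K)] with x h₁ h₂
  rw [h₁, h₂]; rfl

/-- Real competitors correspond to only some of the complex ones, so minimality passes to the
smaller class. -/
lemma IsFourierStepMin.isStepMin {f : L2R} {r s l m : ℝ} {U K u k : L2R}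
    (h : IsFourierStepMin (hat f) r s l m (hat U) (hat K) (hat u) (hat k)) :
    IsStepMin f r s l m U K u k := by
  intro v w
  rw [objective_eq, objective_eq]
  exact h _ _

/-! ### Measurable selection of a minimizer -/

/-- The least minimizer of `g` on `[0, ∞)`. -/
noncomputable def leastArgmin (g : ℝ → ℝ) : ℝ :=
  sInf {p | 0 ≤ p ∧ ∀ p', 0 ≤ p' → g p ≤ g p'}

lemma leastArgmin_spec {g : ℝ → ℝ} (hg : Continuous g)
    (hne : ∃ p, 0 ≤ p ∧ ∀ p', 0 ≤ p' → g p ≤ g p') :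
    0 ≤ leastArgmin g ∧ ∀ p', 0 ≤ p' → g (leastArgmin g) ≤ g p' := by
  have hclosed : IsClosed {p | 0 ≤ p ∧ ∀ p', 0 ≤ p' → g p ≤ g p'} := by
    simp only [ofPred_and, ofPred_forall]
    exact isClosed_Ici.inter (isClosed_iInter fun p' => isClosed_iInter fun _ =>
      isClosed_le hg continuous_const)
  exact hclosed.csInf_mem hne ⟨0, fun p hp => hp.1⟩

/-- The least minimizer is at most `t` exactly when the minimum over `[0, t]` is the minimum over
`[0, ∞)`. By continuity it suffices to test the dense points `min |w| t` and `|y|` with rational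
`w`, `y`, allowing a slack `1 / (n + 1)`. This countable form yields measurability. -/
lemma leastArgmin_le_iff {g : ℝ → ℝ} (hg : Continuous g)
    (hne : ∃ p, 0 ≤ p ∧ ∀ p', 0 ≤ p' → g p ≤ g p') {t : ℝ} (ht : 0 ≤ t) :
    leastArgmin g ≤ t ↔
      ∀ (y : ℚ) (n : ℕ), ∃ w : ℚ, g (min |(w : ℝ)| t) < g |(y : ℝ)| + 1 / ((n : ℝ) + 1) := by
  obtain ⟨h₀, hmin⟩ := leastArgmin_spec hg hne
  constructor
  · intro hle y n
    have hopen : IsOpen {w : ℝ | g (min |w| t) < g |(y : ℝ)| + 1 / ((n : ℝ) + 1)} :=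
      isOpen_lt (by fun_prop) continuous_const
    refine Rat.denseRange_cast.exists_mem_open hopen ⟨leastArgmin g, ?_⟩
    have : (0 : ℝ) < 1 / ((n : ℝ) + 1) := by positivity
    simp only [mem_ofPred_eq, abs_of_nonneg h₀, min_eq_left hle]
    linarith [hmin |(y : ℝ)| (abs_nonneg _)]
  · intro H
    obtain ⟨p, hp, hpmin⟩ := (isCompact_Icc (a := (0 : ℝ)) (b := t)).exists_isMinOn
      ⟨0, le_rfl, ht⟩ hg.continuousOn
    have hrat : ∀ y : ℚ, g p ≤ g |(y : ℝ)| := by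
      intro y
      refine le_of_forall_pos_lt_add fun ε hε => ?_
      obtain ⟨n, hn⟩ := exists_nat_one_div_lt hε
      obtain ⟨w, hw⟩ := H y n
      have := isMinOn_iff.1 hpmin (min |(w : ℝ)| t) ⟨le_min (abs_nonneg _) ht, min_le_right _ _⟩
      linarith
    have hreal : ∀ y : ℝ, g p ≤ g |y| := fun y =>
      Rat.denseRange_cast.induction_on (p := fun y : ℝ => g p ≤ g |y|) y
        (isClosed_le continuous_const (by fun_prop)) hrat
    have hmem : p ∈ {p | 0 ≤ p ∧ ∀ p', 0 ≤ p' → g p ≤ g p'} :=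
      ⟨hp.1, fun p' hp' => by simpa [abs_of_nonneg hp'] using hreal p'⟩
    exact (csInf_le ⟨0, fun p hp => hp.1⟩ hmem).trans hp.2

lemma measurable_leastArgmin {X : Type*} [MeasurableSpace X] {G : X → ℝ → ℝ}
    (hm : ∀ p, Measurable fun x => G x p) (hc : ∀ x, Continuous (G x))
    (hne : ∀ x, ∃ p, 0 ≤ p ∧ ∀ p', 0 ≤ p' → G x p ≤ G x p') :
    Measurable fun x => leastArgmin (G x) := by
  refine measurable_of_Iic fun t => ?_
  rcases lt_or_ge t 0 with ht | ht
  · convert MeasurableSet.empty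
    ext x
    simpa using ht.trans_le (leastArgmin_spec (hc x) (hne x)).1
  · have : (fun x => leastArgmin (G x)) ⁻¹' Iic t = ⋂ (y : ℚ) (n : ℕ), ⋃ w : ℚ,
        {x | G x (min |(w : ℝ)| t) < G x |(y : ℝ)| + 1 / ((n : ℝ) + 1)} := by
      ext x
      simp [leastArgmin_le_iff (hc x) (hne x) ht]
    rw [this]
    exact MeasurableSet.iInter fun y => MeasurableSet.iInter fun n => MeasurableSet.iUnion fun w =>
      measurableSet_lt (hm _) ((hm _).add_const _)

/-! ### The problem at a single frequency -/

/-- The pointwise objective for real data and real increments. -/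
def realObjective (z p₀ q₀ a b p q : ℝ) : ℝ :=
  (z - (p + p₀) * (q + q₀)) ^ 2 + a * p ^ 2 + b * q ^ 2

lemma pointObjective_ofReal (z p₀ q₀ a b p q : ℝ) :
    pointObjective z p₀ q₀ a b p q = realObjective z p₀ q₀ a b p q := by
  have h : (z : ℂ) - (p + p₀) * (q + q₀) = ((z - (p + p₀) * (q + q₀) : ℝ) : ℂ) := by push_cast; ring
  rw [pointObjective, realObjective, h]
  simp only [Complex.norm_real, Real.norm_eq_abs, sq_abs]

/-- Complex increments can be replaced by nonnegative ones without increasing the objective. -/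
lemma exists_realObjective_le {z p₀ q₀ a b : ℝ} (hp₀ : 0 ≤ p₀) (hq₀ : 0 ≤ q₀) (ha : 0 ≤ a)
    (hb : 0 ≤ b) (hz : p₀ * q₀ ≤ z) (v h : ℂ) :
    ∃ p q : ℝ, 0 ≤ p ∧ 0 ≤ q ∧
      realObjective z p₀ q₀ a b p q ≤ pointObjective z p₀ q₀ a b v h := by
  have hcont : ContinuousOn (fun t : ℝ => (t * ‖v‖ + p₀) * (t * ‖h‖ + q₀)) (Icc 0 1) := by fun_prop
  rcases le_total ((‖v‖ + p₀) * (‖h‖ + q₀)) z with hle | hle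
  · refine ⟨‖v‖, ‖h‖, norm_nonneg _, norm_nonneg _, ?_⟩
    have h₁ : ‖(v + p₀) * (h + q₀)‖ ≤ (‖v‖ + p₀) * (‖h‖ + q₀) := by
      rw [norm_mul]
      gcongr
      · exact (norm_add_le _ _).trans (by simp [abs_of_nonneg hp₀])
      · exact (norm_add_le _ _).trans (by simp [abs_of_nonneg hq₀])
    have h₂ : z - ‖(v + p₀) * (h + q₀)‖ ≤ ‖(z : ℂ) - (v + p₀) * (h + q₀)‖ := by
      refine le_trans ?_ (norm_sub_norm_le _ _)
      rw [Complex.norm_real]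
      gcongr
      exact le_abs_self z
    have h₃ : (z - (‖v‖ + p₀) * (‖h‖ + q₀)) ^ 2 ≤ ‖(z : ℂ) - (v + p₀) * (h + q₀)‖ ^ 2 :=
      pow_le_pow_left₀ (by linarith) (by linarith) 2
    unfold realObjective pointObjective
    linarith
  -- When the moduli overshoot `z`, shrinking both by a common factor `t` makes the residual vanish
  -- while the penalties do not grow; `p₀ * q₀ ≤ z` provides the lower endpoint.
  · obtain ⟨t, ⟨ht₀, ht₁⟩, ht⟩ := intermediate_value_Icc (zero_le_one' ℝ) hcont
      (show z ∈ Icc _ _ by simpa using ⟨hz, hle⟩)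
    refine ⟨t * ‖v‖, t * ‖h‖, by positivity, by positivity, ?_⟩
    simp only at ht
    have ht2 : t ^ 2 ≤ 1 := pow_le_one₀ ht₀ ht₁
    have h₁ : a * (t * ‖v‖) ^ 2 ≤ a * ‖v‖ ^ 2 := by
      rw [mul_pow]
      exact mul_le_mul_of_nonneg_left (mul_le_of_le_one_left (by positivity) ht2) ha
    have h₂ : b * (t * ‖h‖) ^ 2 ≤ b * ‖h‖ ^ 2 := by
      rw [mul_pow]
      exact mul_le_mul_of_nonneg_left (mul_le_of_le_one_left (by positivity) ht2) hb
    have h₃ : 0 ≤ ‖(z : ℂ) - (v + p₀) * (h + q₀)‖ ^ 2 := by positivity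
    unfold realObjective pointObjective
    rw [ht]
    linarith

/-- The kernel increment that is optimal for a given image increment. -/
noncomputable def bestKernel (z p₀ q₀ b p : ℝ) : ℝ :=
  (z - (p + p₀) * q₀) * (p + p₀) / ((p + p₀) ^ 2 + b)

/-- The objective, minimized over the kernel increment. -/
noncomputable def reducedObjective (z p₀ q₀ a b p : ℝ) : ℝ :=
  b * (z - (p + p₀) * q₀) ^ 2 / ((p + p₀) ^ 2 + b) + a * p ^ 2

/-- Completes the square in the kernel increment, for a fixed image increment. -/
lemma realObjective_eq {b : ℝ} (hb : 0 < b) (z p₀ q₀ a p q : ℝ) :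
    realObjective z p₀ q₀ a b p q = reducedObjective z p₀ q₀ a b p
      + ((p + p₀) ^ 2 + b) * (q - bestKernel z p₀ q₀ b p) ^ 2 := by
  have h : (p + p₀) ^ 2 + b ≠ 0 := by positivity
  unfold realObjective reducedObjective bestKernel
  field_simp
  ring

lemma realObjective_bestKernel {b : ℝ} (hb : 0 < b) (z p₀ q₀ a p : ℝ) :
    realObjective z p₀ q₀ a b p (bestKernel z p₀ q₀ b p) = reducedObjective z p₀ q₀ a b p := by
  rw [realObjective_eq hb]; ring

lemma reducedObjective_le {b : ℝ} (hb : 0 < b) (z p₀ q₀ a p q : ℝ) :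
    reducedObjective z p₀ q₀ a b p ≤ realObjective z p₀ q₀ a b p q := by
  rw [realObjective_eq hb]
  have : 0 ≤ ((p + p₀) ^ 2 + b) * (q - bestKernel z p₀ q₀ b p) ^ 2 := by positivity
  linarith

lemma continuous_reducedObjective {b : ℝ} (hb : 0 < b) (z p₀ q₀ a : ℝ) :
    Continuous (reducedObjective z p₀ q₀ a b) := by
  unfold reducedObjective
  refine Continuous.add (Continuous.div (by fun_prop) (by fun_prop) fun p => ?_) (by fun_prop)
  positivity

lemma exists_reducedObjective_min {a b : ℝ} (ha : 0 < a) (hb : 0 < b) (z p₀ q₀ : ℝ) :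
    ∃ p, 0 ≤ p ∧ ∀ p', 0 ≤ p' → reducedObjective z p₀ q₀ a b p ≤ reducedObjective z p₀ q₀ a b p' := by
  set g := reducedObjective z p₀ q₀ a b with hg
  have hge : ∀ p, a * p ^ 2 ≤ g p := fun p => by
    have : 0 ≤ b * (z - (p + p₀) * q₀) ^ 2 / ((p + p₀) ^ 2 + b) := by positivity
    simp only [hg, reducedObjective]
    linarith
  have hg₀ : 0 ≤ g 0 := by simpa using hge 0
  -- Beyond this radius the penalty `a * p ^ 2` alone exceeds `g 0`, so minimizing over a compact
  -- interval suffices.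
  set R := √(g 0 / a)
  obtain ⟨p, hp, hmin⟩ := (isCompact_Icc (a := (0 : ℝ)) (b := R)).exists_isMinOn
    ⟨0, le_rfl, Real.sqrt_nonneg _⟩ (continuous_reducedObjective hb z p₀ q₀ a).continuousOn
  refine ⟨p, hp.1, fun p' hp' => ?_⟩
  rcases le_or_gt p' R with h | h
  · exact isMinOn_iff.1 hmin p' ⟨hp', h⟩
  · have h₁ : g p ≤ g 0 := isMinOn_iff.1 hmin 0 ⟨le_rfl, Real.sqrt_nonneg _⟩
    have h₂ : g 0 / a < p' ^ 2 := (Real.sqrt_lt' ((Real.sqrt_nonneg _).trans_lt h)).1 h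
    rw [div_lt_iff₀ ha] at h₂
    linarith [hge p']

/-! ### One step of the pointwise iteration -/

/-- The admissible states of the pointwise iteration: nothing has happened yet at thresholded
frequencies, and the data are not reached at the others. -/
structure IsAdmissible (z c p₀ q₀ : ℝ) : Prop where
  image_nonneg : 0 ≤ p₀
  kernel_nonneg : 0 ≤ q₀
  mul_lt : c < z ^ 2 → p₀ * q₀ < z
  eq_zero : z ^ 2 ≤ c → p₀ = 0 ∧ q₀ = 0

lemma IsAdmissible.mul_le {z c p₀ q₀ : ℝ} (h : IsAdmissible z c p₀ q₀) (hz : 0 ≤ z) :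
    p₀ * q₀ ≤ z := by
  rcases lt_or_ge c (z ^ 2) with hc | hc
  · exact (h.mul_lt hc).le
  · simpa [(h.eq_zero hc).1] using hz

/-- A frequency released by the smaller threshold still has `p₀ = q₀ = 0`, and there `z > 0`, so the
strict inequality holds. -/
lemma IsAdmissible.mono {z c c' p₀ q₀ : ℝ} (h : IsAdmissible z c p₀ q₀) (hz : 0 ≤ z)
    (hc' : 0 < c') (hcc : c' ≤ c) : IsAdmissible z c' p₀ q₀ where
  image_nonneg := h.image_nonneg
  kernel_nonneg := h.kernel_nonneg
  mul_lt := by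
    intro h₁
    rcases lt_or_ge c (z ^ 2) with hc | hc
    · exact h.mul_lt hc
    · have : z ≠ 0 := by
        rintro rfl
        norm_num at h₁
        linarith
      simpa [(h.eq_zero hc).1] using lt_of_le_of_ne hz this.symm
  eq_zero := fun h₁ => h.eq_zero (h₁.trans hcc)

/-- A global minimizer satisfies the first order condition for the image increment. -/
lemma image_stationary {z p₀ q₀ a b p q : ℝ} (ha : 0 < a)
    (hmin : ∀ p', realObjective z p₀ q₀ a b p q ≤ realObjective z p₀ q₀ a b p' q) :
    a * p = (z - (p + p₀) * (q + q₀)) * (q + q₀) := by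
  set Q := q + q₀ with hQ
  have hd : 0 < Q ^ 2 + a := by positivity
  -- The competitor is the unique minimizer of the quadratic in the image increment, so `p` must
  -- equal it.
  have h := hmin ((z - p₀ * Q) * Q / (Q ^ 2 + a))
  have e : ∀ p', realObjective z p₀ q₀ a b p' q = a * (z - p₀ * Q) ^ 2 / (Q ^ 2 + a) + b * q ^ 2
      + (Q ^ 2 + a) * (p' - (z - p₀ * Q) * Q / (Q ^ 2 + a)) ^ 2 := by
    intro p'
    unfold realObjective
    rw [← hQ]
    field_simp
    ring
  rw [e, e, sub_self] at h
  have h₂ : (p - (z - p₀ * Q) * Q / (Q ^ 2 + a)) ^ 2 ≤ 0 := by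
    by_contra hcon
    have := mul_pos hd (not_le.1 hcon)
    nlinarith
  have h₃ : p = (z - p₀ * Q) * Q / (Q ^ 2 + a) := by
    have := pow_eq_zero_iff (two_ne_zero) |>.1 (le_antisymm h₂ (sq_nonneg _))
    linarith
  rw [eq_div_iff hd.ne'] at h₃
  linarith

lemma kernel_stationary {b : ℝ} (hb : 0 < b) (z p₀ q₀ p : ℝ) :
    b * bestKernel z p₀ q₀ b p
      = (z - (p + p₀) * (bestKernel z p₀ q₀ b p + q₀)) * (p + p₀) := by
  have h : (p + p₀) ^ 2 + b ≠ 0 := by positivity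
  unfold bestKernel
  field_simp
  ring

/-- Without previous increments and above the threshold, zero increments are not optimal. -/
lemma exists_realObjective_lt {z a b : ℝ} (hb : 0 < b) (hz : 0 < z) (hab : a * b < z ^ 2) :
    ∃ p q : ℝ, realObjective z 0 0 a b p q < z ^ 2 := by
  -- Along `(√e * b, √e * z)` the objective is `z ^ 2 - e * b * (z ^ 2 - a * b) + e ^ 2 * b ^ 2 * z
  -- ^ 2`; this `e` minimizes it.
  set e := (z ^ 2 - a * b) / (2 * b * z ^ 2) with he
  have hd : 0 < z ^ 2 - a * b := by linarith
  have he0 : 0 < e := by positivity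
  have hs : √e ^ 2 = e := Real.sq_sqrt he0.le
  refine ⟨√e * b, √e * z, ?_⟩
  have h₁ : realObjective z 0 0 a b (√e * b) (√e * z)
      = z ^ 2 + √e ^ 2 * b * (a * b - z ^ 2) + (√e ^ 2) ^ 2 * b ^ 2 * z ^ 2 := by
    unfold realObjective; ring
  rw [h₁, hs]
  have h₂ : e * (2 * b * z ^ 2) = z ^ 2 - a * b := by
    rw [he]; field_simp
  have h₃ : e ^ 2 * b ^ 2 * z ^ 2 = e * b * (z ^ 2 - a * b) / 2 := by
    rw [← h₂]; ring
  rw [h₃]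
  have : 0 < e * b * (z ^ 2 - a * b) := by positivity
  linarith

/-- The image increment of one step of the pointwise iteration. -/
noncomputable def imageStep (z p₀ q₀ a b : ℝ) : ℝ := leastArgmin (reducedObjective z p₀ q₀ a b)

/-- The kernel increment of one step of the pointwise iteration. -/
noncomputable def kernelStep (z p₀ q₀ a b : ℝ) : ℝ :=
  bestKernel z p₀ q₀ b (imageStep z p₀ q₀ a b)

section Step

variable {z p₀ q₀ a b : ℝ}

lemma imageStep_nonneg (ha : 0 < a) (hb : 0 < b) : 0 ≤ imageStep z p₀ q₀ a b :=
  (leastArgmin_spec (continuous_reducedObjective hb z p₀ q₀ a)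
    (exists_reducedObjective_min ha hb z p₀ q₀)).1

/-- Minimality on a half-line extends to all complex pairs: pass to nonnegative increments, then to
the best kernel, then to the least minimizer. -/
lemma realObjective_step_le (ha : 0 < a) (hb : 0 < b) (hz : 0 ≤ z)
    (h : IsAdmissible z (a * b) p₀ q₀) (v w : ℂ) :
    realObjective z p₀ q₀ a b (imageStep z p₀ q₀ a b) (kernelStep z p₀ q₀ a b)
      ≤ pointObjective z p₀ q₀ a b v w := by
  obtain ⟨p, q, hp, -, hpq⟩ := exists_realObjective_le h.image_nonneg h.kernel_nonneg ha.le hb.le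
    (h.mul_le hz) v w
  rw [kernelStep, realObjective_bestKernel hb]
  exact ((leastArgmin_spec (continuous_reducedObjective hb z p₀ q₀ a)
    (exists_reducedObjective_min ha hb z p₀ q₀)).2 p hp).trans
    ((reducedObjective_le hb z p₀ q₀ a p q).trans hpq)

lemma realObjective_step_le_real (ha : 0 < a) (hb : 0 < b) (hz : 0 ≤ z)
    (h : IsAdmissible z (a * b) p₀ q₀) (p q : ℝ) :
    realObjective z p₀ q₀ a b (imageStep z p₀ q₀ a b) (kernelStep z p₀ q₀ a b)
      ≤ realObjective z p₀ q₀ a b p q := by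
  rw [← pointObjective_ofReal z p₀ q₀ a b p q]
  exact realObjective_step_le ha hb hz h p q

lemma imageStep_stationary (ha : 0 < a) (hb : 0 < b) (hz : 0 ≤ z)
    (h : IsAdmissible z (a * b) p₀ q₀) :
    a * imageStep z p₀ q₀ a b = (z - (imageStep z p₀ q₀ a b + p₀) * (kernelStep z p₀ q₀ a b + q₀))
      * (kernelStep z p₀ q₀ a b + q₀) :=
  image_stationary ha fun p' => realObjective_step_le_real ha hb hz h p' _

/-- Above the threshold the increments are nonnegative, the image increment is positive, and the
data are still not reached. -/
lemma step_of_lt (ha : 0 < a) (hb : 0 < b) (hz : 0 ≤ z)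
    (h : IsAdmissible z (a * b) p₀ q₀) (hab : a * b < z ^ 2) :
    0 < imageStep z p₀ q₀ a b ∧ 0 ≤ kernelStep z p₀ q₀ a b ∧
      (imageStep z p₀ q₀ a b + p₀) * (kernelStep z p₀ q₀ a b + q₀) < z := by
  have hp := imageStep_nonneg (z := z) (p₀ := p₀) (q₀ := q₀) ha hb
  have e₁ := imageStep_stationary ha hb hz h
  have e₂ : b * kernelStep z p₀ q₀ a b = _ := kernel_stationary hb z p₀ q₀ (imageStep z p₀ q₀ a b)
  have hle := realObjective_step_le_real ha hb hz h
  have hz' : 0 < z := by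
    refine lt_of_le_of_ne hz fun h0 => ?_
    rw [← h0] at hab
    nlinarith [mul_pos ha hb]
  have hlt := h.mul_lt hab
  have hp₀ := h.image_nonneg
  have hq₀ := h.kernel_nonneg
  have hQ : 0 ≤ kernelStep z p₀ q₀ a b + q₀ := by
    have hd : (imageStep z p₀ q₀ a b + p₀) ^ 2 + b ≠ 0 := by positivity
    have : kernelStep z p₀ q₀ a b + q₀ = (z * (imageStep z p₀ q₀ a b + p₀) + b * q₀)
        / ((imageStep z p₀ q₀ a b + p₀) ^ 2 + b) := by
      unfold kernelStep bestKernel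
      field_simp
      ring
    rw [this]
    positivity
  change _ = (z - (imageStep z p₀ q₀ a b + p₀) * (kernelStep z p₀ q₀ a b + q₀)) * _ at e₂
  set p := imageStep z p₀ q₀ a b
  set q := kernelStep z p₀ q₀ a b
  -- A nonpositive residual would give `p = 0` and `q ≤ 0` by stationarity, so the new product would
  -- be at most `p₀ * q₀ < z`.
  have hD : 0 < z - (p + p₀) * (q + q₀) := by
    by_contra hcon
    have hcon := not_lt.1 hcon
    have hp0 : p = 0 := by
      have : a * p ≤ 0 := e₁ ▸ mul_nonpos_of_nonpos_of_nonneg hcon hQ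
      nlinarith
    have hq0 : q ≤ 0 := by
      have : b * q ≤ 0 := e₂ ▸ mul_nonpos_of_nonpos_of_nonneg hcon (by positivity)
      by_contra hq
      linarith [mul_pos hb (not_le.1 hq)]
    rw [hp0, zero_add] at hcon
    nlinarith [mul_le_mul_of_nonneg_left (show q + q₀ ≤ q₀ by linarith) hp₀]
  have hq : 0 ≤ q := by
    have : 0 ≤ b * q := e₂ ▸ mul_nonneg hD.le (by positivity)
    exact nonneg_of_mul_nonneg_right this hb
  refine ⟨?_, hq, by linarith⟩
  -- If `p = 0`, stationarity with positive residual forces `q`, `q₀` and `p₀` to vanish too, and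
  -- from that state zero increments are not optimal.
  refine lt_of_le_of_ne hp fun hp0 => ?_
  have hQ0 : q + q₀ = 0 := by
    rw [← hp0, mul_zero] at e₁
    rcases mul_eq_zero.1 e₁.symm with h' | h'
    · rw [← hp0] at hD; linarith
    · exact h'
  have hq0 : q = 0 := by linarith
  have hq₀0 : q₀ = 0 := by linarith
  have hp₀0 : p₀ = 0 := by
    rw [hq0, mul_zero] at e₂
    rcases mul_eq_zero.1 e₂.symm with h' | h'
    · rw [hq0] at hD; linarith
    · linarith
  obtain ⟨v, w, hvw⟩ := exists_realObjective_lt hb hz' hab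
  have h₁ := hle v w
  rw [hp₀0, hq₀0] at h₁
  have h₂ : realObjective z 0 0 a b p q = z ^ 2 := by
    rw [← hp0, hq0]; unfold realObjective; ring
  linarith

/-- Below the threshold the increments vanish. -/
lemma step_of_ge (ha : 0 < a) (hb : 0 < b) (hz : 0 ≤ z)
    (h : IsAdmissible z (a * b) p₀ q₀) (hab : z ^ 2 ≤ a * b) :
    imageStep z p₀ q₀ a b = 0 ∧ kernelStep z p₀ q₀ a b = 0 := by
  have hp := imageStep_nonneg (z := z) (p₀ := p₀) (q₀ := q₀) ha hb
  have e₁ := imageStep_stationary ha hb hz h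
  have e₂ : b * kernelStep z p₀ q₀ a b = _ := kernel_stationary hb z p₀ q₀ (imageStep z p₀ q₀ a b)
  have ek : kernelStep z p₀ q₀ a b = bestKernel z p₀ q₀ b (imageStep z p₀ q₀ a b) := rfl
  change _ = (z - (imageStep z p₀ q₀ a b + p₀) * (kernelStep z p₀ q₀ a b + q₀)) * _ at e₂
  obtain ⟨hp₀, hq₀⟩ := h.eq_zero hab
  set p := imageStep z p₀ q₀ a b
  set q := kernelStep z p₀ q₀ a b
  simp only [hp₀, hq₀, add_zero, bestKernel, mul_zero, sub_zero] at e₁ e₂ ek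
  have hq : 0 ≤ q := by rw [ek]; positivity
  have hp0 : p = 0 := by
    by_contra hne
    have hpp : 0 < p := lt_of_le_of_ne hp (Ne.symm hne)
    have hDq : 0 < (z - p * q) * q := e₁ ▸ mul_pos ha hpp
    have hqq : 0 < q := lt_of_le_of_ne hq fun h0 => by simp [← h0] at hDq
    have hD : 0 < z - p * q := pos_of_mul_pos_left hDq hq
    -- Combining the two stationarity equations makes `a * b` the squared residual, which is smaller
    -- than `z ^ 2` if `p` and `q` are positive.
    have h₁ : a * b * p = (z - p * q) ^ 2 * p := by
      calc a * b * p = b * (a * p) := by ring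
        _ = (z - p * q) * (b * q) := by rw [e₁]; ring
        _ = _ := by rw [e₂]; ring
    have h₂ : a * b = (z - p * q) ^ 2 := mul_right_cancel₀ hne h₁
    have h₃ : (z - p * q) ^ 2 < z ^ 2 :=
      pow_lt_pow_left₀ (by linarith [mul_pos hpp hqq]) hD.le two_ne_zero
    linarith
  exact ⟨hp0, by rw [ek, hp0]; simp⟩

lemma kernelStep_nonneg (ha : 0 < a) (hb : 0 < b) (hz : 0 ≤ z)
    (h : IsAdmissible z (a * b) p₀ q₀) : 0 ≤ kernelStep z p₀ q₀ a b := by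
  rcases lt_or_ge (a * b) (z ^ 2) with hab | hab
  · exact (step_of_lt ha hb hz h hab).2.1
  · exact (step_of_ge ha hb hz h hab).2.ge

lemma IsAdmissible.step (ha : 0 < a) (hb : 0 < b) (hz : 0 ≤ z)
    (h : IsAdmissible z (a * b) p₀ q₀) :
    IsAdmissible z (a * b) (p₀ + imageStep z p₀ q₀ a b) (q₀ + kernelStep z p₀ q₀ a b) where
  image_nonneg := add_nonneg h.image_nonneg (imageStep_nonneg ha hb)
  kernel_nonneg := add_nonneg h.kernel_nonneg (kernelStep_nonneg ha hb hz h)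
  mul_lt hab := by
    rw [add_comm p₀, add_comm q₀]
    exact (step_of_lt ha hb hz h hab).2.2
  eq_zero hab := by
    rw [(step_of_ge ha hb hz h hab).1, (step_of_ge ha hb hz h hab).2, add_zero, add_zero]
    exact h.eq_zero hab

end Step

/-! ### The first iterate and soft thresholding -/

/-- The modulus of the first image iterate; with `a` and `b` exchanged, of the first kernel
iterate. -/
noncomputable def initAmplitude (z a b : ℝ) : ℝ := √(max (√(b / a) * z - b) 0)

/-- Exposes the threshold `√a * √b`, shared by image and kernel; the prefactors of the two squares
are reciprocal and cancel in their product. -/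
lemma initAmplitude_sq {a b : ℝ} (ha : 0 < a) (hb : 0 < b) (z : ℝ) :
    initAmplitude z a b ^ 2 = √b / √a * max (z - √a * √b) 0 := by
  have h : √(b / a) * z - b = √b / √a * (z - √a * √b) := by
    have hα : √a ≠ 0 := by positivity
    rw [Real.sqrt_div hb.le]
    field_simp
    linear_combination √a * Real.sq_sqrt hb.le
  rw [initAmplitude, Real.sq_sqrt (le_max_right _ _), h, mul_max_of_nonneg _ _ (by positivity),
    mul_zero]

lemma initAmplitude_mul {a b : ℝ} (ha : 0 < a) (hb : 0 < b) (z : ℝ) :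
    initAmplitude z a b * initAmplitude z b a = max (z - √a * √b) 0 := by
  have hα : √a ≠ 0 := by positivity
  have hβ : √b ≠ 0 := by positivity
  have h₀ : 0 ≤ initAmplitude z a b * initAmplitude z b a :=
    mul_nonneg (Real.sqrt_nonneg _) (Real.sqrt_nonneg _)
  refine (sq_eq_sq₀ h₀ (le_max_right _ _)).1 ?_
  rw [mul_pow, initAmplitude_sq ha hb, initAmplitude_sq hb ha, mul_comm √b √a]
  field_simp

lemma initAmplitude_eq_zero {a b z : ℝ} (ha : 0 < a) (hb : 0 < b) (h : z ^ 2 ≤ a * b) :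
    initAmplitude z a b = 0 := by
  have h₁ : z ≤ √a * √b := by
    rw [← Real.sqrt_mul ha.le]
    exact Real.le_sqrt_of_sq_le h
  have h₂ := initAmplitude_sq ha hb z
  rw [max_eq_right (by linarith), mul_zero] at h₂
  exact pow_eq_zero_iff two_ne_zero |>.1 h₂

lemma isAdmissible_initAmplitude {a b z : ℝ} (ha : 0 < a) (hb : 0 < b) (hz : 0 ≤ z) :
    IsAdmissible z (a * b) (initAmplitude z a b) (initAmplitude z b a) where
  image_nonneg := Real.sqrt_nonneg _
  kernel_nonneg := Real.sqrt_nonneg _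
  mul_lt h := by
    have hc : 0 < √a * √b := by positivity
    have hz' : 0 < z := lt_of_le_of_ne hz fun h0 => by
      rw [← h0] at h
      nlinarith [mul_pos ha hb]
    rw [initAmplitude_mul ha hb]
    exact max_lt (by linarith) hz'
  eq_zero h := ⟨initAmplitude_eq_zero ha hb h, initAmplitude_eq_zero hb ha (by linarith)⟩

/-- With `c = √a * √b` and `t = ‖v‖ * ‖w‖`, the reverse triangle inequality and AM-GM bound the
objective below by `(z - t) ^ 2 + 2 * c * t`. Over `t ≥ 0` this is least at `max (z - c) 0`; the
initial amplitudes have this product and equal penalties, so they attain the bound. -/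
lemma realObjective_initAmplitude_le {a b z : ℝ} (ha : 0 < a) (hb : 0 < b) (hz : 0 ≤ z)
    (v w : ℂ) :
    realObjective z 0 0 a b (initAmplitude z a b) (initAmplitude z b a)
      ≤ pointObjective z (0 : ℝ) (0 : ℝ) a b v w := by
  have hα : 0 < √a := by positivity
  have hβ : 0 < √b := by positivity
  have e : realObjective z 0 0 a b (initAmplitude z a b) (initAmplitude z b a)
      = (z - max (z - √a * √b) 0) ^ 2 + 2 * (√a * √b) * max (z - √a * √b) 0 := by
    unfold realObjective
    rw [add_zero, add_zero, initAmplitude_mul ha hb, initAmplitude_sq ha hb,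
      initAmplitude_sq hb ha, mul_comm √b √a]
    have e₁ : a * (√b / √a) = √a * √b := by
      nth_rewrite 1 [← Real.sq_sqrt ha.le]
      field_simp
    have e₂ : b * (√a / √b) = √a * √b := by
      nth_rewrite 1 [← Real.sq_sqrt hb.le]
      field_simp
    rw [← mul_assoc a, ← mul_assoc b, e₁, e₂]
    ring
  have h₁ : (z - ‖v‖ * ‖w‖) ^ 2 ≤ ‖(z : ℂ) - v * w‖ ^ 2 := by
    rw [← sq_abs]
    refine pow_le_pow_left₀ (abs_nonneg _) ?_ 2
    have := abs_norm_sub_norm_le (z : ℂ) (v * w)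
    rwa [norm_mul, Complex.norm_real, Real.norm_of_nonneg hz] at this
  have h₂ : 2 * (√a * √b) * (‖v‖ * ‖w‖) ≤ a * ‖v‖ ^ 2 + b * ‖w‖ ^ 2 := by
    have := sq_nonneg (√a * ‖v‖ - √b * ‖w‖)
    rw [sub_sq, mul_pow, mul_pow, Real.sq_sqrt ha.le, Real.sq_sqrt hb.le] at this
    linarith
  have h₃ : 0 ≤ ‖v‖ * ‖w‖ := by positivity
  have h₄ : 0 < √a * √b := by positivity
  rw [e]
  simp only [pointObjective, Complex.ofReal_zero, add_zero]
  refine le_trans ?_ (show (z - ‖v‖ * ‖w‖) ^ 2 + 2 * (√a * √b) * (‖v‖ * ‖w‖) ≤ _ by linarith)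
  rcases le_total (√a * √b) z with h | h
  · rw [max_eq_left (by linarith)]
    nlinarith [sq_nonneg (z - √a * √b - ‖v‖ * ‖w‖)]
  · rw [max_eq_right (by linarith)]
    nlinarith [mul_nonneg h₃ (sub_nonneg.2 h)]

/-! ### Iteration, bounds and phases -/

/-- The moduli of the image and the kernel iterates at a frequency where the datum has modulus `z`
and the penalties have the weights `a n` and `b n`. -/
noncomputable def amplitudes (z : ℝ) (a b : ℕ → ℝ) : ℕ → ℝ × ℝ
  | 0 => (initAmplitude z (a 0) (b 0), initAmplitude z (b 0) (a 0))
  | n + 1 =>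
    ((amplitudes z a b n).1
        + imageStep z (amplitudes z a b n).1 (amplitudes z a b n).2 (a (n + 1)) (b (n + 1)),
      (amplitudes z a b n).2
        + kernelStep z (amplitudes z a b n).1 (amplitudes z a b n).2 (a (n + 1)) (b (n + 1)))

section Amplitudes

variable {z : ℝ} {a b : ℕ → ℝ}

lemma isAdmissible_amplitudes (hz : 0 ≤ z) (ha : ∀ n, 0 < a n) (hb : ∀ n, 0 < b n)
    (ha' : Antitone a) (hb' : Antitone b) (n : ℕ) :
    IsAdmissible z (a n * b n) (amplitudes z a b n).1 (amplitudes z a b n).2 := by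
  induction n with
  | zero => exact isAdmissible_initAmplitude (ha 0) (hb 0) hz
  | succ n ih =>
    exact (ih.mono hz (mul_pos (ha _) (hb _)) (mul_le_mul (ha' n.le_succ) (hb' n.le_succ)
      (hb _).le (ha _).le)).step (ha _) (hb _) hz

/-- The step leaving state `n` uses the weights of index `n + 1`, so the invariant is needed at the
lower threshold. -/
lemma isAdmissible_amplitudes_succ (hz : 0 ≤ z) (ha : ∀ n, 0 < a n) (hb : ∀ n, 0 < b n)
    (ha' : Antitone a) (hb' : Antitone b) (n : ℕ) :
    IsAdmissible z (a (n + 1) * b (n + 1)) (amplitudes z a b n).1 (amplitudes z a b n).2 :=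
  (isAdmissible_amplitudes hz ha hb ha' hb' n).mono hz (mul_pos (ha _) (hb _))
    (mul_le_mul (ha' n.le_succ) (hb' n.le_succ) (hb _).le (ha _).le)

end Amplitudes

/-- A lower bound for the weights bounds increments that improve on zero increments. -/
lemma abs_le_of_realObjective_le {z p₀ q₀ a b p q l m : ℝ} (hl : 0 < l) (hm : 0 < m)
    (hla : l ≤ a) (hmb : m ≤ b) (hz : 0 ≤ z) (h₀ : 0 ≤ p₀ * q₀) (h₁ : p₀ * q₀ ≤ z)
    (h : realObjective z p₀ q₀ a b p q ≤ realObjective z p₀ q₀ a b 0 0) :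
    |p| ≤ (√l)⁻¹ * z ∧ |q| ≤ (√m)⁻¹ * z := by
  have h₂ : realObjective z p₀ q₀ a b 0 0 ≤ z ^ 2 := by
    have : realObjective z p₀ q₀ a b 0 0 = (z - p₀ * q₀) ^ 2 := by unfold realObjective; ring
    rw [this]
    exact pow_le_pow_left₀ (by linarith) (by linarith) 2
  have h₃ : l * p ^ 2 + m * q ^ 2 ≤ z ^ 2 := by
    have h₄ := mul_le_mul_of_nonneg_right hla (sq_nonneg p)
    have h₅ := mul_le_mul_of_nonneg_right hmb (sq_nonneg q)
    have h₆ := sq_nonneg (z - (p + p₀) * (q + q₀))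
    unfold realObjective at h h₂
    linarith
  have key : ∀ {c t : ℝ}, 0 < c → c * t ^ 2 ≤ z ^ 2 → |t| ≤ (√c)⁻¹ * z := by
    intro c t hc ht
    rw [inv_mul_eq_div, le_div_iff₀ (Real.sqrt_pos.2 hc)]
    refine abs_le_of_sq_le_sq' ?_ hz |>.2
    rw [mul_pow, sq_abs, Real.sq_sqrt hc.le]
    linarith
  exact ⟨key hl (by nlinarith [sq_nonneg q]), key hm (by nlinarith [sq_nonneg p])⟩

lemma norm_sgn {z : ℂ} (hz : z ≠ 0) : ‖sgn z‖ = 1 := by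
  rw [sgn, norm_div, Complex.norm_real, norm_norm, div_self (norm_ne_zero_iff.2 hz)]

lemma sgn_zero : sgn 0 = 0 := by simp [sgn]

lemma norm_sgn_le (z : ℂ) : ‖sgn z‖ ≤ 1 := by
  rcases eq_or_ne z 0 with rfl | hz
  · simp [sgn_zero]
  · exact (norm_sgn hz).le

lemma sgn_conj (z : ℂ) : sgn (conj z) = conj (sgn z) := by
  simp [sgn]

lemma sgn_mul_norm (z : ℂ) : sgn z * (‖z‖ : ℂ) = z := by
  rcases eq_or_ne z 0 with rfl | hz
  · simp
  · rw [sgn, div_mul_cancel₀]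
    simpa using hz

lemma sgn_sgn_mul {z : ℂ} {t : ℝ} (ht : 0 < t) : sgn (sgn z * (t : ℂ)) = sgn z := by
  rcases eq_or_ne z 0 with rfl | hz
  · simp [sgn_zero]
  · have h : ‖sgn z * (t : ℂ)‖ = t := by
      rw [norm_mul, norm_sgn hz, one_mul, Complex.norm_real, Real.norm_of_nonneg ht.le]
    have ht' : (t : ℂ) ≠ 0 := by exact_mod_cast ht.ne'
    conv_lhs => rw [sgn, h]
    rw [mul_div_cancel_right₀ _ ht']

lemma pointObjective_sgn_mul {z : ℂ} (hz : z ≠ 0) (p₀ q₀ : ℂ) (a b : ℝ) (v w : ℂ) :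
    pointObjective z (sgn z * p₀) q₀ a b (sgn z * v) w
      = pointObjective (‖z‖ : ℝ) p₀ q₀ a b v w := by
  have h : z - (sgn z * v + sgn z * p₀) * (w + q₀)
      = sgn z * ((‖z‖ : ℝ) - (v + p₀) * (w + q₀)) := by
    rw [mul_sub, sgn_mul_norm]; ring
  unfold pointObjective
  rw [h, norm_mul, norm_mul, norm_sgn hz, one_mul, one_mul]

/-- The pointwise problem for a complex datum reduces to the one for its modulus. -/
lemma pointObjective_le_of_modulus {z : ℂ} {p₀ q₀ a b p q : ℝ} (ha : 0 ≤ a) (hb : 0 ≤ b)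
    (hq : z = 0 → q = 0)
    (h : ∀ v w : ℂ, realObjective ‖z‖ p₀ q₀ a b p q ≤ pointObjective (‖z‖ : ℝ) p₀ q₀ a b v w)
    (v w : ℂ) :
    pointObjective z (sgn z * p₀) q₀ a b (sgn z * p) q
      ≤ pointObjective z (sgn z * p₀) q₀ a b v w := by
  rcases eq_or_ne z 0 with hz | hz
  -- At `z = 0` the phase is zero and cannot be divided out, but the objective already vanishes.
  · have h₁ : pointObjective z (sgn z * p₀) q₀ a b (sgn z * p) q = 0 := by
      simp [pointObjective, hz, hq hz, sgn_zero]
    rw [h₁]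
    unfold pointObjective
    positivity
  · have hs : sgn z ≠ 0 := fun h0 => by simpa [h0] using norm_sgn hz
    rw [pointObjective_sgn_mul hz, show v = sgn z * (v / sgn z) by field_simp,
      pointObjective_sgn_mul hz, pointObjective_ofReal]
    exact h _ _

/-! ### From single frequencies to `L²` -/

lemma one_le_Δ (x : Plane) : 1 ≤ Δ x := by
  unfold Δ
  nlinarith [sq_nonneg ‖x‖]

lemma Δ_pos (x : Plane) : 0 < Δ x := zero_lt_one.trans_le (one_le_Δ x)

lemma Δ_neg (x : Plane) : Δ (-x) = Δ x := by simp [Δ]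

lemma measurable_Δ : Measurable Δ := by unfold Δ; fun_prop

lemma enorm_sq_eq_ofReal (z : ℂ) : ‖z‖ₑ ^ 2 = ENNReal.ofReal (‖z‖ ^ 2) := by
  rw [ENNReal.ofReal_pow (norm_nonneg _), ofReal_norm]

lemma fourierObjective_eq_lintegral (F : L2C) (r s : ℝ) {l m : ℝ} (hl : 0 ≤ l) (hm : 0 ≤ m)
    (P Q p q : L2C) :
    fourierObjective F r s l m P Q p q = ∫⁻ x, ENNReal.ofReal
      (pointObjective (F x) (P x) (Q x) (l * Δ x ^ r) (m * Δ x ^ s) (p x) (q x)) := by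
  have hmeas : ∀ (c t : ℝ) (g : L2C), Measurable fun x => ENNReal.ofReal c *
      (ENNReal.ofReal (Δ x ^ t) * ‖g x‖ₑ ^ 2) := fun c t g =>
    (((measurable_Δ.pow_const t).ennreal_ofReal).mul
      ((Lp.stronglyMeasurable g).measurable.enorm.pow_const 2)).const_mul _
  have h₁ : eLpNorm (fun x => F x - (p x + P x) * (q x + Q x)) 2 volume ^ 2
      = ∫⁻ x, ‖F x - (p x + P x) * (q x + Q x)‖ₑ ^ 2 := by
    have := eLpNorm_nnreal_pow_eq_lintegral (μ := volume) (p := 2)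
      (f := fun x => F x - (p x + P x) * (q x + Q x)) two_ne_zero
    simpa using this
  rw [fourierObjective, h₁, weightedSq, weightedSq,
    ← lintegral_const_mul' _ _ ENNReal.ofReal_ne_top,
    ← lintegral_const_mul' _ _ ENNReal.ofReal_ne_top,
    ← lintegral_add_right _ (hmeas l r p), ← lintegral_add_right _ (hmeas m s q)]
  refine lintegral_congr fun x => ?_
  have hr : 0 ≤ Δ x ^ r := Real.rpow_nonneg (Δ_pos x).le r
  have hs : 0 ≤ Δ x ^ s := Real.rpow_nonneg (Δ_pos x).le s
  simp only [enorm_sq_eq_ofReal]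
  rw [pointObjective, ENNReal.ofReal_add (by positivity) (by positivity),
    ENNReal.ofReal_add (by positivity) (by positivity), mul_assoc, mul_assoc,
    ENNReal.ofReal_mul hl, ENNReal.ofReal_mul hm, ENNReal.ofReal_mul hr, ENNReal.ofReal_mul hs]

lemma isFourierStepMin_of_pointwise {F P Q p q : L2C} {r s l m : ℝ} (hl : 0 ≤ l) (hm : 0 ≤ m)
    (h : ∀ᵐ x, ∀ v w : ℂ,
      pointObjective (F x) (P x) (Q x) (l * Δ x ^ r) (m * Δ x ^ s) (p x) (q x)
        ≤ pointObjective (F x) (P x) (Q x) (l * Δ x ^ r) (m * Δ x ^ s) v w) :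
    IsFourierStepMin F r s l m P Q p q := by
  intro v w
  rw [fourierObjective_eq_lintegral F r s hl hm, fourierObjective_eq_lintegral F r s hl hm]
  refine lintegral_mono_ae ?_
  filter_upwards [h] with x hx using ENNReal.ofReal_le_ofReal (hx _ _)

lemma initAmplitude_weights (l m r s z : ℝ) (x : Plane) :
    initAmplitude z (l * Δ x ^ r) (m * Δ x ^ s)
      = √(max (√(m / l * Δ x ^ (s - r)) * z - m * Δ x ^ s) 0) := by
  rw [initAmplitude, Real.rpow_sub (Δ_pos x), mul_div_mul_comm]

lemma ae_comp_neg {p : Plane → Prop} (h : ∀ᵐ x, p x) : ∀ᵐ x, p (-x) :=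
  (Measure.measurePreserving_neg (volume : Measure Plane)).quasiMeasurePreserving.ae h

lemma IsHermitian.add {g h : L2C} (hg : IsHermitian g) (hh : IsHermitian h) :
    IsHermitian (g + h) := by
  filter_upwards [hg, hh, Lp.coeFn_add g h, ae_comp_neg (Lp.coeFn_add g h)] with x h₁ h₂ h₃ h₄
  rw [h₃, h₄, Pi.add_apply, Pi.add_apply, map_add, ← h₁, ← h₂]

lemma IsHermitian.norm_comp_neg {g : L2C} (hg : IsHermitian g) : ∀ᵐ x, ‖g (-x)‖ = ‖g x‖ := by
  filter_upwards [hg] with x hx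
  rw [hx, Complex.norm_conj]

/-- A function with the phase of a Hermitian `F` and an even modulus is Hermitian. -/
lemma isHermitian_of_sgn_mul {F P : L2C} (hF : IsHermitian F) {ρ : Plane → ℝ}
    (hρ : ∀ᵐ x, ρ (-x) = ρ x) (hP : ∀ᵐ x, P x = sgn (F x) * (ρ x : ℂ)) : IsHermitian P := by
  filter_upwards [hF, hρ, hP, ae_comp_neg hP] with x h₁ h₂ h₃ h₄
  rw [h₄, h₃, h₂, map_mul, Complex.conj_ofReal, ← sgn_conj, ← h₁]

lemma isHermitian_of_real {Q : L2C} {κ : Plane → ℝ}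
    (hκ : ∀ᵐ x, κ (-x) = κ x) (hQ : ∀ᵐ x, Q x = (κ x : ℂ)) : IsHermitian Q := by
  filter_upwards [hκ, hQ, ae_comp_neg hQ] with x h₂ h₃ h₄
  rw [h₄, h₃, h₂, Complex.conj_ofReal]

lemma IsNonneg.add {g h : L2C} (hg : IsNonneg g) (hh : IsNonneg h) : IsNonneg (g + h) := by
  filter_upwards [hg, hh, Lp.coeFn_add g h] with x h₁ h₂ h₃
  rw [h₃, Pi.add_apply, Complex.add_im, Complex.add_re, h₁.1, h₂.1]
  exact ⟨add_zero 0, add_nonneg h₁.2 h₂.2⟩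

lemma isNonneg_of_real {Q : L2C} {κ : Plane → ℝ} (hκ : ∀ᵐ x, 0 ≤ κ x)
    (hQ : ∀ᵐ x, Q x = (κ x : ℂ)) : IsNonneg Q := by
  filter_upwards [hκ, hQ] with x h₁ h₂
  rw [h₂]
  exact ⟨Complex.ofReal_im _, h₁⟩

/-! ### Recipes yield MHDM iterates -/

section Recipe

variable {F : L2C} {r s : ℝ} {lam mu : ℕ → ℝ} {P Q : ℕ → L2C}

lemma IsFourierRecipe.image_zero (h : IsFourierRecipe F r s lam mu P Q) :
    ∀ᵐ x, P 0 x = sgn (F x) *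
      (initAmplitude ‖F x‖ (lam 0 * Δ x ^ r) (mu 0 * Δ x ^ s) : ℝ) := by
  filter_upwards [h.init_image] with x hx
  rw [hx, initAmplitude_weights]

lemma IsFourierRecipe.kernel_zero (h : IsFourierRecipe F r s lam mu P Q) :
    ∀ᵐ x, Q 0 x = (initAmplitude ‖F x‖ (mu 0 * Δ x ^ s) (lam 0 * Δ x ^ r) : ℝ) := by
  filter_upwards [h.init_kernel] with x hx
  rw [hx, initAmplitude_weights]

lemma IsFourierRecipe.isHermitian_image (h : IsFourierRecipe F r s lam mu P Q)
    (hF : IsHermitian F) (n : ℕ) : IsHermitian (P n) := by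
  induction n with
  | zero =>
    refine isHermitian_of_sgn_mul hF ?_ h.image_zero
    filter_upwards [hF.norm_comp_neg] with x hx
    rw [hx, Δ_neg]
  | succ n ih =>
    rw [← add_sub_cancel (P n) (P (n + 1))]
    exact ih.add (h.image_symm n)

lemma IsFourierRecipe.isHermitian_kernel (h : IsFourierRecipe F r s lam mu P Q)
    (hF : IsHermitian F) (n : ℕ) : IsHermitian (Q n) := by
  induction n with
  | zero =>
    refine isHermitian_of_real ?_ h.kernel_zero
    filter_upwards [hF.norm_comp_neg] with x hx
    rw [hx, Δ_neg]
  | succ n ih =>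
    rw [← add_sub_cancel (Q n) (Q (n + 1))]
    refine ih.add ?_
    filter_upwards [h.kernel_symm n, h.kernel_nonneg n] with x h₁ h₂
    rw [← h₁, Complex.conj_eq_iff_im.2 h₂.1]

lemma IsFourierRecipe.isNonneg_kernel (h : IsFourierRecipe F r s lam mu P Q) (n : ℕ) :
    IsNonneg (Q n) := by
  induction n with
  | zero =>
    exact isNonneg_of_real (Filter.Eventually.of_forall fun x => Real.sqrt_nonneg _) h.kernel_zero
  | succ n ih =>
    rw [← add_sub_cancel (Q n) (Q (n + 1))]
    exact ih.add (h.kernel_nonneg n)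

lemma IsFourierRecipe.init_min (h : IsFourierRecipe F r s lam mu P Q)
    (hlam : 0 < lam 0) (hmu : 0 < mu 0) :
    IsFourierStepMin F r s (lam 0) (mu 0) 0 0 (P 0) (Q 0) := by
  refine isFourierStepMin_of_pointwise hlam.le hmu.le ?_
  filter_upwards [h.image_zero, h.kernel_zero, Lp.coeFn_zero ℂ 2 (volume : Measure Plane)]
    with x h₁ h₂ h₃ v w
  have ha : 0 < lam 0 * Δ x ^ r := mul_pos hlam (Real.rpow_pos_of_pos (Δ_pos x) r)
  have hb : 0 < mu 0 * Δ x ^ s := mul_pos hmu (Real.rpow_pos_of_pos (Δ_pos x) s)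
  have key := pointObjective_le_of_modulus (z := F x) (p₀ := 0) (q₀ := 0) ha.le hb.le ?_
    (realObjective_initAmplitude_le ha hb (norm_nonneg (F x))) v w
  · rw [h₁, h₂, h₃]
    simpa using key
  · intro hz
    refine initAmplitude_eq_zero hb ha ?_
    rw [hz, norm_zero]
    nlinarith [mul_pos ha hb]

end Recipe

lemma IsFourierRecipe.isMHDM {f : L2R} {r s : ℝ} {lam mu : ℕ → ℝ} {U K : ℕ → L2R}
    (hlam : ∀ n, 0 < lam n) (hmu : ∀ n, 0 < mu n)
    (h : IsFourierRecipe (hat f) r s lam mu (fun n => hat (U n)) (fun n => hat (K n))) :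
    IsMHDM f r s lam mu U K where
  init := by
    refine IsFourierStepMin.isStepMin ?_
    rw [hat_zero]
    exact h.init_min (hlam 0) (hmu 0)
  step n := by
    refine IsFourierStepMin.isStepMin ?_
    rw [hat_sub, hat_sub]
    exact h.step_min n

/-! ### Construction of a recipe -/

section Construction

/-- The moduli of the iterates at the frequency `x`. -/
noncomputable def amplitudesAt (F : L2C) (r s : ℝ) (lam mu : ℕ → ℝ) (n : ℕ) (x : Plane) : ℝ × ℝ :=
  amplitudes ‖F x‖ (fun n => lam n * Δ x ^ r) (fun n => mu n * Δ x ^ s) n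

variable {F : L2C} {r s : ℝ} {lam mu : ℕ → ℝ}

lemma weight_pos {c : ℝ} (hc : 0 < c) (t : ℝ) (x : Plane) : 0 < c * Δ x ^ t :=
  mul_pos hc (Real.rpow_pos_of_pos (Δ_pos x) t)

lemma le_weight {c t : ℝ} (hc : 0 < c) (ht : 0 ≤ t) (x : Plane) : c ≤ c * Δ x ^ t :=
  le_mul_of_one_le_right hc.le (Real.one_le_rpow (one_le_Δ x) ht)

lemma antitone_weight {c : ℕ → ℝ} (hc : Antitone c) (t : ℝ) (x : Plane) :
    Antitone fun n => c n * Δ x ^ t := fun _ _ h =>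
  mul_le_mul_of_nonneg_right (hc h) (Real.rpow_nonneg (Δ_pos x).le t)

lemma measurable_weight (c t : ℝ) : Measurable fun x => c * Δ x ^ t :=
  (measurable_Δ.pow_const t).const_mul c

lemma measurable_initAmplitude {z a b : Plane → ℝ} (hz : Measurable z) (ha : Measurable a)
    (hb : Measurable b) : Measurable fun x => initAmplitude (z x) (a x) (b x) :=
  ((((hb.div ha).sqrt.mul hz).sub hb).max measurable_const).sqrt

section Step

variable {z p₀ q₀ a b : Plane → ℝ}

lemma measurable_imageStep (hz : Measurable z) (hp₀ : Measurable p₀) (hq₀ : Measurable q₀)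
    (ha : Measurable a) (hb : Measurable b) (ha' : ∀ x, 0 < a x) (hb' : ∀ x, 0 < b x) :
    Measurable fun x => imageStep (z x) (p₀ x) (q₀ x) (a x) (b x) := by
  refine measurable_leastArgmin (fun p => ?_) (fun x => continuous_reducedObjective (hb' x) _ _ _ _)
    fun x => exists_reducedObjective_min (ha' x) (hb' x) _ _ _
  unfold reducedObjective
  fun_prop

lemma measurable_kernelStep (hz : Measurable z) (hp₀ : Measurable p₀) (hq₀ : Measurable q₀)
    (ha : Measurable a) (hb : Measurable b) (ha' : ∀ x, 0 < a x) (hb' : ∀ x, 0 < b x) :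
    Measurable fun x => kernelStep (z x) (p₀ x) (q₀ x) (a x) (b x) := by
  have := measurable_imageStep hz hp₀ hq₀ ha hb ha' hb'
  unfold kernelStep bestKernel
  fun_prop

end Step

lemma measurable_amplitudesAt (hlam : ∀ n, 0 < lam n) (hmu : ∀ n, 0 < mu n) (n : ℕ) :
    Measurable (amplitudesAt F r s lam mu n) := by
  have hz : Measurable fun x => ‖F x‖ := (Lp.stronglyMeasurable F).measurable.norm
  induction n with
  | zero =>
    exact (measurable_initAmplitude hz (measurable_weight _ _) (measurable_weight _ _)).prodMk
      (measurable_initAmplitude hz (measurable_weight _ _) (measurable_weight _ _))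
  | succ n ih =>
    exact (ih.fst.add (measurable_imageStep hz ih.fst ih.snd (measurable_weight _ _)
      (measurable_weight _ _) (weight_pos (hlam _) r) (weight_pos (hmu _) s))).prodMk
      (ih.snd.add (measurable_kernelStep hz ih.fst ih.snd (measurable_weight _ _)
      (measurable_weight _ _) (weight_pos (hlam _) r) (weight_pos (hmu _) s)))

lemma isAdmissible_amplitudesAt (hlam : ∀ n, 0 < lam n) (hmu : ∀ n, 0 < mu n)
    (hlam' : Antitone lam) (hmu' : Antitone mu) (n : ℕ) (x : Plane) :
    IsAdmissible ‖F x‖ ((lam (n + 1) * Δ x ^ r) * (mu (n + 1) * Δ x ^ s))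
      (amplitudesAt F r s lam mu n x).1 (amplitudesAt F r s lam mu n x).2 :=
  isAdmissible_amplitudes_succ (norm_nonneg _) (fun n => weight_pos (hlam n) r x)
    (fun n => weight_pos (hmu n) s x) (antitone_weight hlam' r x) (antitone_weight hmu' s x) n

/-- The image increment at the frequency `x`. -/
noncomputable def imageStepAt (F : L2C) (r s : ℝ) (lam mu : ℕ → ℝ) (n : ℕ) (x : Plane) : ℝ :=
  imageStep ‖F x‖ (amplitudesAt F r s lam mu n x).1 (amplitudesAt F r s lam mu n x).2
    (lam (n + 1) * Δ x ^ r) (mu (n + 1) * Δ x ^ s)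

/-- The kernel increment at the frequency `x`. -/
noncomputable def kernelStepAt (F : L2C) (r s : ℝ) (lam mu : ℕ → ℝ) (n : ℕ) (x : Plane) : ℝ :=
  kernelStep ‖F x‖ (amplitudesAt F r s lam mu n x).1 (amplitudesAt F r s lam mu n x).2
    (lam (n + 1) * Δ x ^ r) (mu (n + 1) * Δ x ^ s)

lemma measurable_imageStepAt (hlam : ∀ n, 0 < lam n) (hmu : ∀ n, 0 < mu n) (n : ℕ) :
    Measurable (imageStepAt F r s lam mu n) :=
  have hm := measurable_amplitudesAt (F := F) (r := r) (s := s) hlam hmu n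
  measurable_imageStep (Lp.stronglyMeasurable F).measurable.norm hm.fst hm.snd
    (measurable_weight _ _) (measurable_weight _ _) (weight_pos (hlam _) r) (weight_pos (hmu _) s)

lemma measurable_kernelStepAt (hlam : ∀ n, 0 < lam n) (hmu : ∀ n, 0 < mu n) (n : ℕ) :
    Measurable (kernelStepAt F r s lam mu n) :=
  have hm := measurable_amplitudesAt (F := F) (r := r) (s := s) hlam hmu n
  measurable_kernelStep (Lp.stronglyMeasurable F).measurable.norm hm.fst hm.snd
    (measurable_weight _ _) (measurable_weight _ _) (weight_pos (hlam _) r) (weight_pos (hmu _) s)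

lemma amplitudesAt_succ_fst (n : ℕ) (x : Plane) : (amplitudesAt F r s lam mu (n + 1) x).1
    = (amplitudesAt F r s lam mu n x).1 + imageStepAt F r s lam mu n x := rfl

lemma amplitudesAt_succ_snd (n : ℕ) (x : Plane) : (amplitudesAt F r s lam mu (n + 1) x).2
    = (amplitudesAt F r s lam mu n x).2 + kernelStepAt F r s lam mu n x := rfl

/-- Since `Δ ≥ 1` and the exponents are nonnegative, the weights are bounded below by `lam n` and
`mu n`, so each increment is dominated by a multiple of `‖F x‖`. -/
lemma memLp_amplitudesAt (hr : 0 ≤ r) (hs : 0 ≤ s) (hlam : ∀ n, 0 < lam n) (hmu : ∀ n, 0 < mu n)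
    (hlam' : Antitone lam) (hmu' : Antitone mu) (n : ℕ) :
    MemLp (fun x => (amplitudesAt F r s lam mu n x).1) 2 volume ∧
      MemLp (fun x => (amplitudesAt F r s lam mu n x).2) 2 volume := by
  have hm := measurable_amplitudesAt (F := F) (r := r) (s := s) hlam hmu
  induction n with
  | zero =>
    have hle : ∀ x, |(amplitudesAt F r s lam mu 0 x).1| ≤ (√(lam 0))⁻¹ * ‖F x‖ ∧
        |(amplitudesAt F r s lam mu 0 x).2| ≤ (√(mu 0))⁻¹ * ‖F x‖ := by
      intro x
      refine abs_le_of_realObjective_le (p₀ := 0) (q₀ := 0) (hlam 0) (hmu 0)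
        (le_weight (hlam 0) hr x) (le_weight (hmu 0) hs x) (norm_nonneg _) (by simp) (by simp) ?_
      rw [← pointObjective_ofReal _ _ _ _ _ 0 0]
      exact realObjective_initAmplitude_le (weight_pos (hlam 0) r x) (weight_pos (hmu 0) s x)
        (norm_nonneg _) _ _
    exact ⟨(Lp.memLp F).of_le_mul (hm 0).fst.aestronglyMeasurable
        (Filter.Eventually.of_forall fun x => (hle x).1),
      (Lp.memLp F).of_le_mul (hm 0).snd.aestronglyMeasurable
        (Filter.Eventually.of_forall fun x => (hle x).2)⟩
  | succ n ih =>
    have hle : ∀ x, |imageStepAt F r s lam mu n x| ≤ (√(lam (n + 1)))⁻¹ * ‖F x‖ ∧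
        |kernelStepAt F r s lam mu n x| ≤ (√(mu (n + 1)))⁻¹ * ‖F x‖ := by
      intro x
      have hadm := isAdmissible_amplitudesAt (F := F) (r := r) (s := s) hlam hmu hlam' hmu' n x
      exact abs_le_of_realObjective_le (hlam _) (hmu _) (le_weight (hlam _) hr x)
        (le_weight (hmu _) hs x) (norm_nonneg _)
        (mul_nonneg hadm.image_nonneg hadm.kernel_nonneg) (hadm.mul_le (norm_nonneg _))
        (realObjective_step_le_real (weight_pos (hlam _) r x) (weight_pos (hmu _) s x)
          (norm_nonneg _) hadm 0 0)
    exact ⟨ih.1.add ((Lp.memLp F).of_le_mul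
        (measurable_imageStepAt hlam hmu n).aestronglyMeasurable
        (Filter.Eventually.of_forall fun x => (hle x).1)),
      ih.2.add ((Lp.memLp F).of_le_mul
        (measurable_kernelStepAt hlam hmu n).aestronglyMeasurable
        (Filter.Eventually.of_forall fun x => (hle x).2))⟩

lemma measurable_sgn : Measurable sgn := by
  unfold sgn
  fun_prop

/-- The canonical choice of minimizer depends on `x` only through the even quantities `‖F x‖` and `Δ
x`; an arbitrary choice could break the symmetry. -/
lemma amplitudesAt_neg (hF : IsHermitian F) (n : ℕ) :
    ∀ᵐ x, amplitudesAt F r s lam mu n (-x) = amplitudesAt F r s lam mu n x := by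
  filter_upwards [hF.norm_comp_neg] with x hx
  simp only [amplitudesAt, hx, Δ_neg]

lemma threshold_eq (l m r s : ℝ) (x : Plane) :
    l * m * Δ x ^ (r + s) = (l * Δ x ^ r) * (m * Δ x ^ s) := by
  rw [Real.rpow_add (Δ_pos x)]
  ring

/-- The iterates that are assembled from the pointwise ones satisfy the recipe. -/
lemma exists_isFourierRecipe (hF : IsHermitian F) (hr : 0 ≤ r) (hs : 0 ≤ s)
    (hlam : ∀ n, 0 < lam n) (hmu : ∀ n, 0 < mu n) (hlam' : Antitone lam) (hmu' : Antitone mu) :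
    ∃ P Q : ℕ → L2C, IsFourierRecipe F r s lam mu P Q ∧ IsPointwiseMin F r s lam mu P Q := by
  have hL := memLp_amplitudesAt (F := F) hr hs hlam hmu hlam' hmu'
  have hP : ∀ n, MemLp (fun x => sgn (F x) * ((amplitudesAt F r s lam mu n x).1 : ℂ)) 2 volume :=
    fun n => (hL n).1.of_le ((measurable_sgn.comp (Lp.stronglyMeasurable F).measurable).mul
      (measurable_amplitudesAt hlam hmu n).fst.complex_ofReal).aestronglyMeasurable
      (Filter.Eventually.of_forall fun x => by
        rw [norm_mul, Complex.norm_real]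
        exact mul_le_of_le_one_left (norm_nonneg _) (norm_sgn_le _))
  have hQ : ∀ n, MemLp (fun x => ((amplitudesAt F r s lam mu n x).2 : ℂ)) 2 volume :=
    fun n => (hL n).2.ofReal
  set P : ℕ → L2C := fun n => (hP n).toLp _
  set Q : ℕ → L2C := fun n => (hQ n).toLp _
  have hPn : ∀ n, ∀ᵐ x, P n x = sgn (F x) * ((amplitudesAt F r s lam mu n x).1 : ℂ) :=
    fun n => (hP n).coeFn_toLp
  have hQn : ∀ n, ∀ᵐ x, Q n x = ((amplitudesAt F r s lam mu n x).2 : ℂ) :=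
    fun n => (hQ n).coeFn_toLp
  have hdP : ∀ n, ∀ᵐ x, (P (n + 1) - P n) x = sgn (F x) * (imageStepAt F r s lam mu n x : ℂ) := by
    intro n
    filter_upwards [hPn n, hPn (n + 1), Lp.coeFn_sub (P (n + 1)) (P n)] with x h₁ h₂ h₃
    rw [h₃, Pi.sub_apply, h₁, h₂, amplitudesAt_succ_fst]
    push_cast
    ring
  have hdQ : ∀ n, ∀ᵐ x, (Q (n + 1) - Q n) x = (kernelStepAt F r s lam mu n x : ℂ) := by
    intro n
    filter_upwards [hQn n, hQn (n + 1), Lp.coeFn_sub (Q (n + 1)) (Q n)] with x h₁ h₂ h₃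
    rw [h₃, Pi.sub_apply, h₁, h₂, amplitudesAt_succ_snd]
    push_cast
    ring
  have hadm := isAdmissible_amplitudesAt (F := F) (r := r) (s := s) hlam hmu hlam' hmu'
  have ha : ∀ n x, 0 < lam n * Δ x ^ r := fun n x => weight_pos (hlam n) r x
  have hb : ∀ n x, 0 < mu n * Δ x ^ s := fun n x => weight_pos (hmu n) s x
  have hmin : IsPointwiseMin F r s lam mu P Q := by
    intro n
    filter_upwards [hPn n, hQn n, hdP n, hdQ n] with x h₁ h₂ h₃ h₄ v w
    rw [h₁, h₂, h₃, h₄]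
    refine pointObjective_le_of_modulus (ha _ x).le (hb _ x).le (fun hz => ?_)
      (realObjective_step_le (ha _ x) (hb _ x) (norm_nonneg _) (hadm n x)) v w
    -- Zeros of `F` lie below every threshold, so the kernel increment vanishes there.
    have hle : ‖F x‖ ^ 2 ≤ lam (n + 1) * Δ x ^ r * (mu (n + 1) * Δ x ^ s) := by
      rw [hz, norm_zero, zero_pow two_ne_zero]
      exact (mul_pos (ha _ x) (hb _ x)).le
    exact (step_of_ge (ha _ x) (hb _ x) (norm_nonneg _) (hadm n x) hle).2
  refine ⟨P, Q, ⟨?_, ?_, fun n => ?_, fun n => ?_, fun n => ?_, fun n => ?_, fun n => ?_⟩, hmin⟩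
  · filter_upwards [hPn 0] with x hx
    rw [hx, ← initAmplitude_weights]
    rfl
  · filter_upwards [hQn 0] with x hx
    rw [hx, ← initAmplitude_weights]
    rfl
  · exact isFourierStepMin_of_pointwise (hlam _).le (hmu _).le (hmin n)
  · exact isNonneg_of_real (Filter.Eventually.of_forall fun x =>
      kernelStep_nonneg (ha _ x) (hb _ x) (norm_nonneg _) (hadm n x)) (hdQ n)
  · filter_upwards [hdQ n, ae_comp_neg (hdQ n), hF.norm_comp_neg,
      amplitudesAt_neg (r := r) (s := s) (lam := lam) (mu := mu) hF n]
      with x h₁ h₂ h₃ h₄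
    rw [h₁, h₂]
    simp only [kernelStepAt, h₃, h₄, Δ_neg]
  · refine isHermitian_of_sgn_mul hF ?_ (hdP n)
    filter_upwards [hF.norm_comp_neg,
      amplitudesAt_neg (r := r) (s := s) (lam := lam) (mu := mu) hF n] with x h₃ h₄
    simp only [imageStepAt, h₃, h₄, Δ_neg]
  · filter_upwards [hdP n] with x hx
    rw [hx, threshold_eq]
    refine ⟨fun h => sgn_sgn_mul
      (step_of_lt (ha _ x) (hb _ x) (norm_nonneg _) (hadm n x) h).1, fun h => ?_⟩
    rw [imageStepAt, (step_of_ge (ha _ x) (hb _ x) (norm_nonneg _) (hadm n x) h).1]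
    simp

end Construction

end BlindMHDM

theorem mainTheorem4 (f : BlindMHDM.L2R) (hf : BlindMHDM.IsBandLimited f)
    (r s : ℝ) (hr : 0 ≤ r) (hs : 0 ≤ s)
    (lam mu : ℕ → ℝ) (hlam_pos : ∀ n, 0 < lam n) (hmu_pos : ∀ n, 0 < mu n)
    (hlam : Antitone lam) (hmu : Antitone mu) :
    (∃ U K : ℕ → BlindMHDM.L2R,
      BlindMHDM.IsMHDM f r s lam mu U K ∧
      (∀ n, BlindMHDM.IsNonneg (BlindMHDM.hat (K n))) ∧
      BlindMHDM.IsFourierRecipe (BlindMHDM.hat f) r s lam mu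
        (fun n => BlindMHDM.hat (U n)) (fun n => BlindMHDM.hat (K n)) ∧
      BlindMHDM.IsPointwiseMin (BlindMHDM.hat f) r s lam mu
        (fun n => BlindMHDM.hat (U n)) (fun n => BlindMHDM.hat (K n))) ∧
    (∀ P Q : ℕ → BlindMHDM.L2C,
      BlindMHDM.IsFourierRecipe (BlindMHDM.hat f) r s lam mu P Q →
      ∃ U K : ℕ → BlindMHDM.L2R,
        (∀ n, BlindMHDM.hat (U n) = P n ∧ BlindMHDM.hat (K n) = Q n) ∧
        BlindMHDM.IsMHDM f r s lam mu U K ∧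
        (∀ n, BlindMHDM.IsNonneg (BlindMHDM.hat (K n)))) := by
  -- This is statement (B); statement (A) follows by applying it to the constructed recipe.
  have key : ∀ P Q : ℕ → BlindMHDM.L2C,
      BlindMHDM.IsFourierRecipe (BlindMHDM.hat f) r s lam mu P Q →
      ∃ U K : ℕ → BlindMHDM.L2R,
        (∀ n, BlindMHDM.hat (U n) = P n ∧ BlindMHDM.hat (K n) = Q n) ∧
        BlindMHDM.IsMHDM f r s lam mu U K ∧
        (∀ n, BlindMHDM.IsNonneg (BlindMHDM.hat (K n))) := by
    intro P Q h
    have hF := BlindMHDM.isHermitian_hat f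
    choose U hU using fun n => BlindMHDM.exists_hat_eq (h.isHermitian_image hF n)
    choose K hK using fun n => BlindMHDM.exists_hat_eq (h.isHermitian_kernel hF n)
    obtain rfl : (fun n => BlindMHDM.hat (U n)) = P := funext hU
    obtain rfl : (fun n => BlindMHDM.hat (K n)) = Q := funext hK
    exact ⟨U, K, fun n => ⟨rfl, rfl⟩, h.isMHDM hlam_pos hmu_pos, h.isNonneg_kernel⟩
  refine ⟨?_, key⟩
  obtain ⟨P, Q, h, hmin⟩ := BlindMHDM.exists_isFourierRecipe (BlindMHDM.isHermitian_hat f) hr hs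
    hlam_pos hmu_pos hlam hmu
  obtain ⟨U, K, hUK, hM, hnn⟩ := key P Q h
  obtain rfl : (fun n => BlindMHDM.hat (U n)) = P := funext fun n => (hUK n).1
  obtain rfl : (fun n => BlindMHDM.hat (K n)) = Q := funext fun n => (hUK n).2
  exact ⟨U, K, hM, hnn, h, hmin⟩
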